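/- Let $d$ be a natural number, let $(\Omega,\mathcal F,\mathbb P)$ be a probability space, and let $g$ be a random Riemannian metric on $\mathbb R^d$: for each $\omega$, $g_\omega:\mathbb R^d\to \mathrm{Sym}^+(d)$ takes values in the positive definite symmetric matrices, and each $g(x)$ is measurable in $\omega$. Write $\|v\|_{M}=\sqrt{v^{\mathsf T}Mv}$ and let $$T(x,y)=\inf_{\gamma}\int_a^b\|\gamma'(s)\|_{g(\gamma(s))}\,ds ,$$ the infimum being over all piecewise $C^1$ paths $\gamma:[a,b]\to\mathbb R^d$ from $x$ to $y$. Assume: * (ergodicity) the law of $g$ is invariant under the translations of $\mathbb R^d$, and every event on matrix fields that is invariant (up to null sets) under all translations has probability $0$ or $1$; * (regularity) almost surely $g$ is continuous; * (weak moment condition) $\mathbb E\,\|v\|_{g(0)}<\infty$ for every $v\in\mathbb R^d$. For $A\subset\mathbb R^d$, a *decreasing event over $A$* is a set $E$ of pseudometrics on $\mathbb R^d$ such that (i) $D\in E$ and $D'\le D$ imply $D'\in E$; (ii) $E$ belongs to the $\sigma$-algebra generated by the evaluations $D\mapsto D(x,y)$, $x,y\in A$; (iii) $\{T\in E\}$ coincides,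 up to a null set, with an event in $\sigma(g(x):x\in A)$. For $Q,S>0$ let $$\mathrm{Ind}^-(Q,S)=\sup\bigl|\mathbb P[T\in E_A\cap E_B]-\mathbb P[T\in E_A]\,\mathbb P[T\in E_B]\bigr|,$$ the supremum being over all $A,B\subset\mathbb R^d$ of diameter at most $S$ with $\mathrm{dist}(A,B)>Q$ and all decreasing events $E_A$ over $A$ and $E_B$ over $B$. 1. Suppose that $T$ is exponentially quasi-independent: there is $\beta>0$ such that for every $\alpha>0$ there is $Q_0>0$ with $\mathrm{Ind}^-(Q,Q^{1+\alpha})\le \exp(-Q^{\beta})$ for all $Q\ge Q_0$. Then $T(0,v)$ is integrable for every $v$, and there is a norm $\mu$ on $\mathbb R^d$ such that for every $v\in\mathbb R^d$ $$\frac1n T(0,nv)\longrightarrow\mu(v)\quad\text{almost surely and in }L^1 .$$ 2. The same conclusion holds if, instead of quasi-independence, $g$ has finite range: there is $Q>0$ such that $\sigma(g(x):x\in A)$ and $\sigma(g(x):x\in B)$ are independent whenever $A,B\subset\mathbb R^d$ are at distance at least $Q$. -/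

import Mathlib

open MeasureTheory Filter Topology
open scoped Matrix

namespace RiemannianFPP

/-- `ℝ^d` with its Euclidean norm. -/
abbrev Space (d : ℕ) : Type := EuclideanSpace ℝ (Fin d)

/-- A field of `d × d` real matrices on `ℝ^d`. -/
abbrev MatrixField (d : ℕ) : Type := Space d → Matrix (Fin d) (Fin d) ℝ

/-- The product (equivalently Borel) σ-algebra on real matrices. -/
instance matrixMeasurableSpace (d : ℕ) : MeasurableSpace (Matrix (Fin d) (Fin d) ℝ) :=
  inferInstanceAs (MeasurableSpace (Fin d → Fin d → ℝ))

/-! ### The distance of a Riemannian metric -/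

/-- `‖v‖_M = √(vᵀ M v)`. -/
noncomputable def matrixNorm {d : ℕ} (M : Matrix (Fin d) (Fin d) ℝ) (v : Space d) : ℝ :=
  Real.sqrt (v.ofLp ⬝ᵥ (M *ᵥ v.ofLp))

/-- `γ` is piecewise `C¹` on `[a, b]`: there is a finite subdivision of `[a, b]` such that `γ` is
`C¹` on each of its closed intervals (in particular `γ` is continuous on `[a, b]`). -/
def IsPiecewiseC1 {d : ℕ} (γ : ℝ → Space d) (a b : ℝ) : Prop :=
  ∃ (n : ℕ) (t : ℕ → ℝ), Monotone t ∧ t 0 = a ∧ t n = b ∧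
    ∀ i < n, ContDiffOn ℝ 1 γ (Set.Icc (t i) (t (i + 1)))

/-- The length `∫_a^b ‖γ'(s)‖_{g(γ(s))} ds`. -/
noncomputable def pathLength {d : ℕ} (g : MatrixField d) (γ : ℝ → Space d) (a b : ℝ) : ℝ :=
  ∫ s in a..b, matrixNorm (g (γ s)) (deriv γ s)

/-- The distance `T(x, y)` induced by `g`: the infimum of the `g`-lengths of the piecewise `C¹`
paths from `x` to `y`. -/
noncomputable def riemDist {d : ℕ} (g : MatrixField d) (x y : Space d) : ℝ :=
  sInf {L : ℝ | ∃ (γ : ℝ → Space d) (a b : ℝ), a ≤ b ∧ γ a = x ∧ γ b = y ∧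
    IsPiecewiseC1 γ a b ∧ L = pathLength g γ a b}

section Random

variable {d : ℕ} {Ω : Type*} [MeasurableSpace Ω]

/-! ### Random Riemannian metrics -/

/-- `g` is a random field of positive definite symmetric matrices. -/
structure IsRandomMetric (g : Ω → MatrixField d) : Prop where
  measurable : ∀ x, Measurable (fun ω => g ω x)
  posDef : ∀ ω x, (g ω x).PosDef

/-- `g` is ergodic under the translations of `ℝ^d`: its law on the product space of matrix fields
is translation invariant, and every event of that space which is, up to null sets, invariant under
all translations has probability `0` or `1`. -/
structure IsErgodicField (g : Ω → MatrixField d) (P : Measure Ω) : Prop where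
  stationary : ∀ v : Space d, P.map (fun ω x => g ω (v + x)) = P.map g
  zero_or_one : ∀ S : Set (MatrixField d), MeasurableSet S →
    (∀ v : Space d, {ω | (fun x => g ω (v + x)) ∈ S} =ᵐ[P] {ω | g ω ∈ S}) →
    P {ω | g ω ∈ S} = 0 ∨ P {ω | g ω ∈ S} = 1

/-- The σ-algebra on `Ω` generated by the values of `g` at the points of `A`. -/
@[reducible] def fieldSigma (g : Ω → MatrixField d) (A : Set (Space d)) : MeasurableSpace Ω :=
  ⨆ x ∈ A, MeasurableSpace.comap (fun ω => g ω x) inferInstance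

/-- The Euclidean distance between `A` and `B` (`∞` if one of them is empty). -/
noncomputable def setDist (A B : Set (Space d)) : ENNReal :=
  ⨅ a ∈ A, ⨅ b ∈ B, edist a b

/-- Finite range: the values of `g` over sets at distance at least `Q` are independent. -/
def HasFiniteRange (g : Ω → MatrixField d) (P : Measure Ω) : Prop :=
  ∃ Q : ℝ, 0 < Q ∧ ∀ A B : Set (Space d), ENNReal.ofReal Q ≤ setDist A B →
    ProbabilityTheory.Indep (fieldSigma g A) (fieldSigma g B) P

/-! ### Quasi-independence of the distance -/

/-- The σ-algebra on the set of pseudometrics generated by the evaluations at the pairs of points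
of `A`. -/
@[reducible] def distSigma (A : Set (Space d)) : MeasurableSpace (PseudoMetric (Space d) ℝ) :=
  ⨆ x ∈ A, ⨆ y ∈ A,
    MeasurableSpace.comap (fun D : PseudoMetric (Space d) ℝ => D x y) inferInstance

/-- The event that the distance induced by `g` belongs to the set `E` of pseudometrics. -/
def distEvent (g : Ω → MatrixField d) (E : Set (PseudoMetric (Space d) ℝ)) : Set Ω :=
  {ω | ∃ D ∈ E, ⇑D = riemDist (g ω)}

/-- `E` is a decreasing event on pseudometrics, depending only on what happens over `A`: it is
measurable with respect to the restriction of the pseudometric to `A`, and the event that the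
distance of `g` belongs to `E` is determined, up to a null set, by the values of `g` over `A`. -/
structure IsDecreasingEventOver (g : Ω → MatrixField d) (P : Measure Ω) (A : Set (Space d))
    (E : Set (PseudoMetric (Space d) ℝ)) : Prop where
  decreasing : IsLowerSet E
  measurable : MeasurableSet[distSigma A] E
  localField : ∃ F : Set Ω, MeasurableSet[fieldSigma g A] F ∧ distEvent g E =ᵐ[P] F

/-- `Ind⁻(Q, S)`: the supremum of `|P[E_A ∩ E_B] - P[E_A] P[E_B]|` over the sets `A`, `B` of
diameter at most `S` at distance larger than `Q` and the decreasing events `E_A` over `A` and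
`E_B` over `B`. -/
noncomputable def indMinus (g : Ω → MatrixField d) (P : Measure Ω) (Q S : ℝ) : ℝ :=
  sSup {r : ℝ | ∃ (A B : Set (Space d)) (EA EB : Set (PseudoMetric (Space d) ℝ)),
    Metric.ediam A ≤ ENNReal.ofReal S ∧ Metric.ediam B ≤ ENNReal.ofReal S ∧
    ENNReal.ofReal Q < setDist A B ∧
    IsDecreasingEventOver g P A EA ∧ IsDecreasingEventOver g P B EB ∧
    r = |P.real (distEvent g EA ∩ distEvent g EB)
          - P.real (distEvent g EA) * P.real (distEvent g EB)|}

/-- Exponential quasi-independence of the distance induced by `g`. -/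
def IsExpQuasiIndep (g : Ω → MatrixField d) (P : Measure Ω) : Prop :=
  ∃ β : ℝ, 0 < β ∧ ∀ α : ℝ, 0 < α → ∃ Q₀ : ℝ, 0 < Q₀ ∧ ∀ Q : ℝ, Q₀ ≤ Q →
    indMinus g P Q (Q ^ (1 + α)) ≤ Real.exp (-(Q ^ β))

/-! ### The time constant -/

/-- `μ` is the time constant of `g`: for every `v`, `T(0, nv) / n` converges to `μ(v)` almost surely
and in `L¹`. -/
structure IsTimeConstant (g : Ω → MatrixField d) (P : Measure Ω) (μ : Space d → ℝ) : Prop where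
  tendsto_ae : ∀ v : Space d, ∀ᵐ ω ∂P,
    Tendsto (fun n : ℕ => riemDist (g ω) 0 ((n : ℝ) • v) / n) atTop (𝓝 (μ v))
  integrable : ∀ v : Space d, Integrable (fun ω => riemDist (g ω) 0 v) P
  tendsto_L1 : ∀ v : Space d,
    Tendsto (fun n : ℕ => ∫ ω, |riemDist (g ω) 0 ((n : ℝ) • v) / n - μ v| ∂P) atTop (𝓝 0)

/-- `μ` is a norm on `ℝ^d`. -/
structure IsNorm (μ : Space d → ℝ) : Prop where
  pos : ∀ v, v ≠ 0 → 0 < μ v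
  smul : ∀ (a : ℝ) v, μ (a • v) = |a| * μ v
  add_le : ∀ v w, μ (v + w) ≤ μ v + μ w

end Random

end RiemannianFPP

/-!
The time constant is `μ(v) = inf_n E[T(0, nv)] / n`, where the means are finite because the moment
condition bounds the mean lengths of segments. Three ingredients show that it is a norm and the
limit of `T(0, nv) / n`.

*Deterministic geometry.* Fix a continuous field of positive definite matrices. A function which
varies locally by no more than the lengths of straight segments is `1`-Lipschitz for the distance
(`IsRegular.sub_le_riemDist`), since its right derivative along a path is at most the speed. Applied
to the infimum of the lengths of polygons with vertices in a countable dense set, this shows that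
the distance is a measurable function of the field, and that the event of crossing an annulus fast
depends, up to a null set, on the field in a ball only.

*Convergence.* The events that the upper or the lower limit of `T(0, nv) / n` lies beyond a given
level are invariant under translations up to null sets, because `T(nv, nv + w) / n` tends to zero.
So they have probability zero or one, and it only remains to compare almost sure levels with means.
This is `le_of_ae_exists_block_le`: if almost surely some block `[0, n)` costs at most `c` per step,
then cutting the line greedily into such blocks shows that the mean cost per step is at most `c`.
It is applied to `T` for the lower limit, and to minus the sums of the distances between consecutive
multiples of `mv` for the upper limit. Convergence in mean then follows from Scheffé's lemma.
Homogeneity of `μ` under real multiples comes from the bound of `E[T(0, tv)]` by the mean length of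
a segment, which is linear in `t`.

*Positivity.* This is where quasi-independence enters; it holds for fields of finite range, as
distant events are independent. Let `f_k` be the probability that the annulus between
radii `R_k / 2 ^ (6 + k)` and `R_k` is crossed in time less than `t_k`, where
`R_{k+1} = 2 ^ (6 + k) R_k` and `t_{k+1} = (2 ^ (6 + k) - 11) t_k`. A fast crossing at the scale
`k + 1` forces two fast crossings at the scale `k`, with centres in a finite net and at distance at
least `6 R_k` (`IsRegular.not_crosses_of_pairs`). Hence, for some constant `A`,
`f_{k+1} ≤ A ^ (6 + k) (f_k ^ 2 + exp (-R_k ^ β))`, and the `f_k` stay small if `R_0` is large and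
`f_0` is small; the latter holds for small `t_0`. As `∏ (1 - 11 / 2 ^ (6 + k)) > 0`, the times `t_k`
are bounded below by a multiple of `R_k`, so the distance grows linearly with probability at least
one half at infinitely many scales.
-/

namespace RiemannianFPP

section Geometry

variable {d : ℕ}

/-! ### Norms of vectors and lengths of segments -/

lemma matrixNorm_nonneg (M : Matrix (Fin d) (Fin d) ℝ) (v : Space d) : 0 ≤ matrixNorm M v :=
  Real.sqrt_nonneg _

lemma matrixNorm_smul (M : Matrix (Fin d) (Fin d) ℝ) (c : ℝ) (v : Space d) :
    matrixNorm M (c • v) = |c| * matrixNorm M v := by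
  unfold matrixNorm
  rw [WithLp.ofLp_smul, Matrix.mulVec_smul, smul_dotProduct, dotProduct_smul, smul_eq_mul,
    smul_eq_mul, ← mul_assoc, Real.sqrt_mul (mul_self_nonneg c), Real.sqrt_mul_self_eq_abs]

lemma matrixNorm_neg (M : Matrix (Fin d) (Fin d) ℝ) (v : Space d) :
    matrixNorm M (-v) = matrixNorm M v := by
  simpa using matrixNorm_smul M (-1) v

lemma matrixNorm_zero (M : Matrix (Fin d) (Fin d) ℝ) : matrixNorm M 0 = 0 := by
  simpa using matrixNorm_smul M 0 0

lemma matrixNorm_pos {M : Matrix (Fin d) (Fin d) ℝ} (hM : M.PosDef) {v : Space d} (hv : v ≠ 0) :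
    0 < matrixNorm M v := by
  refine Real.sqrt_pos.2 ?_
  have h : v.ofLp ≠ 0 := fun h => hv (by ext i; simp [h])
  simpa using hM.dotProduct_mulVec_pos h

lemma continuous_matrixNorm :
    Continuous fun p : Matrix (Fin d) (Fin d) ℝ × Space d => matrixNorm p.1 p.2 := by
  unfold matrixNorm
  have h : Continuous fun p : Matrix (Fin d) (Fin d) ℝ × Space d => p.2.ofLp :=
    (PiLp.continuous_ofLp 2 _).comp continuous_snd
  exact (h.dotProduct (continuous_fst.matrix_mulVec h)).sqrt

/-- The metrics to which the deterministic part of the argument applies: continuous fields of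
positive definite matrices. -/
structure IsRegular (M : MatrixField d) : Prop where
  continuous : Continuous M
  posDef : ∀ x, (M x).PosDef

/-- The length of the vector `u` averaged along the segment from `p` to `q`. -/
noncomputable def segMean (M : MatrixField d) (p q u : Space d) : ℝ :=
  ∫ s in (0 : ℝ)..1, matrixNorm (M (p + s • (q - p))) u

/-- The length of the straight segment from `x` to `y`. -/
noncomputable def segLength (M : MatrixField d) (x y : Space d) : ℝ := segMean M x y (y - x)

lemma segMean_nonneg (M : MatrixField d) (p q u : Space d) : 0 ≤ segMean M p q u :=
  intervalIntegral.integral_nonneg zero_le_one fun _ _ => matrixNorm_nonneg _ _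

lemma segLength_nonneg (M : MatrixField d) (x y : Space d) : 0 ≤ segLength M x y :=
  segMean_nonneg _ _ _ _

lemma segMean_smul (M : MatrixField d) (p q u : Space d) (c : ℝ) :
    segMean M p q (c • u) = |c| * segMean M p q u := by
  simp only [segMean, matrixNorm_smul, intervalIntegral.integral_const_mul]

lemma segMean_self (M : MatrixField d) (p u : Space d) :
    segMean M p p u = matrixNorm (M p) u := by
  simp [segMean]

lemma segLength_self (M : MatrixField d) (x : Space d) : segLength M x x = 0 := by
  rw [segLength, segMean_self, sub_self, matrixNorm_zero]

lemma segLength_comm (M : MatrixField d) (x y : Space d) : segLength M x y = segLength M y x := by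
  have h := intervalIntegral.integral_comp_sub_left (a := 0) (b := 1)
    (fun s : ℝ => matrixNorm (M (y + s • (x - y))) (x - y)) 1
  simp only [sub_self, sub_zero] at h
  rw [segLength, segLength, segMean, segMean, ← h]
  congr 1
  ext s
  rw [← matrixNorm_neg _ (y - x), neg_sub]
  congr 2
  module

variable {M : MatrixField d}

lemma IsRegular.continuous_segMean (hM : IsRegular M) :
    Continuous fun p : Space d × Space d × Space d => segMean M p.1 p.2.1 p.2.2 := by
  unfold segMean
  refine intervalIntegral.continuous_parametric_intervalIntegral_of_continuous' ?_ 0 1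
  have h : Continuous fun z : (Space d × Space d × Space d) × ℝ =>
      M (z.1.1 + z.2 • (z.1.2.1 - z.1.1)) := hM.continuous.comp (by fun_prop)
  exact continuous_matrixNorm.comp (h.prodMk (by fun_prop))

lemma IsRegular.continuous_segLength (hM : IsRegular M) :
    Continuous fun p : Space d × Space d => segLength M p.1 p.2 :=
  hM.continuous_segMean.comp
    (by fun_prop : Continuous fun p : Space d × Space d => (p.1, p.2, p.2 - p.1))

/-! ### Piecewise smooth paths and the distance -/

lemma pathLength_nonneg (M : MatrixField d) (γ : ℝ → Space d) {a b : ℝ} (hab : a ≤ b) :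
    0 ≤ pathLength M γ a b :=
  intervalIntegral.integral_nonneg hab fun _ _ => matrixNorm_nonneg _ _

lemma IsPiecewiseC1.le {γ : ℝ → Space d} {a b : ℝ} (h : IsPiecewiseC1 γ a b) : a ≤ b := by
  obtain ⟨n, t, ht, rfl, rfl, -⟩ := h
  exact ht (Nat.zero_le n)

lemma bddBelow_lengths (M : MatrixField d) (x y : Space d) :
    BddBelow {L : ℝ | ∃ (γ : ℝ → Space d) (a b : ℝ), a ≤ b ∧ γ a = x ∧ γ b = y ∧
      IsPiecewiseC1 γ a b ∧ L = pathLength M γ a b} := by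
  refine ⟨0, ?_⟩
  rintro L ⟨γ, a, b, hab, -, -, -, rfl⟩
  exact pathLength_nonneg _ _ hab

lemma riemDist_le_pathLength (M : MatrixField d) {γ : ℝ → Space d} {a b : ℝ}
    (h : IsPiecewiseC1 γ a b) : riemDist M (γ a) (γ b) ≤ pathLength M γ a b :=
  csInf_le (bddBelow_lengths M _ _) ⟨γ, a, b, h.le, rfl, rfl, h, rfl⟩

lemma segment_isPiecewiseC1 (x y : Space d) :
    IsPiecewiseC1 (fun s : ℝ => x + s • (y - x)) 0 1 := by
  refine ⟨1, fun i => i, Nat.mono_cast, by simp, by simp, fun i _ => ?_⟩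
  exact ContDiff.contDiffOn (by fun_prop)

lemma pathLength_segment (M : MatrixField d) (x y : Space d) :
    pathLength M (fun s : ℝ => x + s • (y - x)) 0 1 = segLength M x y := by
  unfold pathLength segLength segMean
  congr 1
  ext s
  congr 1
  have : HasDerivAt (fun s : ℝ => x + s • (y - x)) ((1 : ℝ) • (y - x)) s :=
    ((hasDerivAt_id s).smul_const (y - x)).const_add x
  simpa using this.deriv

lemma riemDist_le_segLength (M : MatrixField d) (x y : Space d) :
    riemDist M x y ≤ segLength M x y := by
  have h := riemDist_le_pathLength M (segment_isPiecewiseC1 x y)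
  rw [pathLength_segment] at h
  simpa using h

lemma lengths_nonempty (M : MatrixField d) (x y : Space d) :
    {L : ℝ | ∃ (γ : ℝ → Space d) (a b : ℝ), a ≤ b ∧ γ a = x ∧ γ b = y ∧
      IsPiecewiseC1 γ a b ∧ L = pathLength M γ a b}.Nonempty :=
  ⟨_, fun s => x + s • (y - x), 0, 1, zero_le_one, by simp, by simp, segment_isPiecewiseC1 x y, rfl⟩

lemma riemDist_nonneg (M : MatrixField d) (x y : Space d) : 0 ≤ riemDist M x y := by
  refine le_csInf (lengths_nonempty M x y) ?_
  rintro L ⟨γ, a, b, hab, -, -, -, rfl⟩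
  exact pathLength_nonneg _ _ hab

lemma riemDist_self (M : MatrixField d) (x : Space d) : riemDist M x x = 0 :=
  le_antisymm ((riemDist_le_segLength M x x).trans_eq (segLength_self M x)) (riemDist_nonneg M x x)

lemma exists_path_lt (M : MatrixField d) {x y : Space d} {r : ℝ} (h : riemDist M x y < r) :
    ∃ (γ : ℝ → Space d) (a b : ℝ), γ a = x ∧ γ b = y ∧ IsPiecewiseC1 γ a b ∧
      pathLength M γ a b < r := by
  obtain ⟨_, ⟨γ, a, b, -, hx, hy, hγ, rfl⟩, hlt⟩ := exists_lt_of_csInf_lt (lengths_nonempty M x y) h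
  exact ⟨γ, a, b, hx, hy, hγ, hlt⟩

/-- A parametrisation by `t ↦ γ (-t)` runs through the path backwards. -/
lemma riemDist_comm (M : MatrixField d) (x y : Space d) : riemDist M x y = riemDist M y x := by
  suffices h : ∀ x y, riemDist M x y ≤ riemDist M y x from le_antisymm (h x y) (h y x)
  intro x y
  refine le_of_forall_gt fun r hr => ?_
  obtain ⟨γ, a, b, rfl, rfl, ⟨n, t, ht, rfl, rfl, hγ⟩, hlt⟩ := exists_path_lt M hr
  have hp : IsPiecewiseC1 (fun s => γ (-s)) (-t n) (-t 0) := by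
    refine ⟨n, fun i => -t (n - i), fun i j hij => neg_le_neg (ht (by omega)), by simp, by simp,
      fun i hi => ?_⟩
    have h1 : n - i = n - (i + 1) + 1 := by omega
    refine (hγ (n - (i + 1)) (by omega)).comp contDiff_neg.contDiffOn fun s hs => ?_
    rw [← h1]
    constructor <;> simp only [Set.mem_Icc] at hs ⊢ <;> linarith [hs.1, hs.2]
  have h := riemDist_le_pathLength M hp
  simp only [neg_neg] at h
  refine h.trans_lt (lt_of_eq_of_lt ?_ hlt)
  have h2 := intervalIntegral.integral_comp_neg (a := -t n) (b := -t 0)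
    (fun s => matrixNorm (M (γ s)) (deriv γ s))
  simp only [neg_neg] at h2
  rw [pathLength, pathLength, ← h2]
  congr 1
  ext s
  rw [deriv_comp_neg (f := γ), matrixNorm_neg]

/-- The length does not see the values of the path outside the open parameter interval. -/
lemma length_integrand_eqOn (M : MatrixField d) {γ γ' : ℝ → Space d} {a b : ℝ}
    (h : Set.EqOn γ γ' (Set.Ioo a b)) :
    Set.EqOn (fun s => matrixNorm (M (γ s)) (deriv γ s))
      (fun s => matrixNorm (M (γ' s)) (deriv γ' s)) (Set.Ioo a b) := by
  intro s hs
  have h1 : γ =ᶠ[𝓝 s] γ' := Filter.eventuallyEq_of_mem (Ioo_mem_nhds hs.1 hs.2) h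
  simp only [h1.deriv_eq, h hs]

/-- The norm of the one-sided velocity, continued to the whole line by a continuous function. -/
lemma exists_continuous_speed (hM : IsRegular M) {γ : ℝ → Space d} {a b : ℝ} (hab : a < b)
    (hγ : ContDiffOn ℝ 1 γ (Set.Icc a b)) :
    ∃ φ : ℝ → ℝ, Continuous φ ∧
      (∀ s ∈ Set.Icc a b, φ s = matrixNorm (M (γ s)) (derivWithin γ (Set.Icc a b) s)) ∧
      Set.EqOn φ (fun s => matrixNorm (M (γ s)) (deriv γ s)) (Set.Ioo a b) := by
  have hc : ContinuousOn (fun s => matrixNorm (M (γ s)) (derivWithin γ (Set.Icc a b) s))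
      (Set.Icc a b) :=
    continuous_matrixNorm.comp_continuousOn
      ((hM.continuous.comp_continuousOn hγ.continuousOn).prodMk
        (hγ.continuousOn_derivWithin (uniqueDiffOn_Icc hab) le_rfl))
  refine ⟨Set.IccExtend hab.le ((Set.Icc a b).domRestrict
    fun s => matrixNorm (M (γ s)) (derivWithin γ (Set.Icc a b) s)),
    (continuousOn_iff_continuous_domRestrict.1 hc).Icc_extend', fun s hs => ?_, fun s hs => ?_⟩
  · rw [Set.IccExtend_of_mem _ _ hs]; rfl
  · rw [Set.IccExtend_of_mem _ _ (Set.Ioo_subset_Icc_self hs)]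
    simp only [← derivWithin_of_mem_nhds (f := γ) (Icc_mem_nhds hs.1 hs.2)]
    rfl

lemma intervalIntegrable_speed_of_contDiffOn (hM : IsRegular M) {γ : ℝ → Space d} {a b : ℝ}
    (hab : a ≤ b) (hγ : ContDiffOn ℝ 1 γ (Set.Icc a b)) :
    IntervalIntegrable (fun s => matrixNorm (M (γ s)) (deriv γ s)) volume a b := by
  rcases hab.eq_or_lt with rfl | hab'
  · exact IntervalIntegrable.refl
  obtain ⟨φ, hφ, -, heq⟩ := exists_continuous_speed hM hab' hγ
  refine (hφ.intervalIntegrable a b).congr_uIoo ?_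
  rwa [Set.uIoo_of_le hab]

lemma IsPiecewiseC1.intervalIntegrable (hM : IsRegular M) {γ : ℝ → Space d} {a b : ℝ}
    (h : IsPiecewiseC1 γ a b) :
    IntervalIntegrable (fun s => matrixNorm (M (γ s)) (deriv γ s)) volume a b := by
  obtain ⟨n, t, ht, rfl, rfl, hγ⟩ := h
  exact IntervalIntegrable.trans_iterate fun k hk =>
    intervalIntegrable_speed_of_contDiffOn hM (ht k.le_succ) (hγ k hk)

lemma IsPiecewiseC1.comp_sub {γ : ℝ → Space d} {a b : ℝ} (h : IsPiecewiseC1 γ a b) (c : ℝ) :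
    IsPiecewiseC1 (fun s => γ (s - c)) (a + c) (b + c) := by
  obtain ⟨n, t, ht, rfl, rfl, hγ⟩ := h
  refine ⟨n, fun i => t i + c, fun i j hij => by simpa using ht hij, rfl, rfl, fun i hi => ?_⟩
  refine (hγ i hi).comp (contDiff_id.sub contDiff_const).contDiffOn fun s hs => ?_
  constructor <;> simp only [Set.mem_Icc] at hs ⊢ <;> linarith [hs.1, hs.2]

lemma pathLength_comp_sub (M : MatrixField d) (γ : ℝ → Space d) (a b c : ℝ) :
    pathLength M (fun s => γ (s - c)) (a + c) (b + c) = pathLength M γ a b := by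
  have h := intervalIntegral.integral_comp_sub_right (a := a + c) (b := b + c)
    (fun s => matrixNorm (M (γ s)) (deriv γ s)) c
  simp only [add_sub_cancel_right] at h
  rw [pathLength, pathLength, ← h]
  congr 1
  ext s
  rw [deriv_comp_sub_const (f := γ)]

/-- Two piecewise smooth paths with a common end point can be glued. -/
lemma IsPiecewiseC1.glue {γ₁ γ₂ : ℝ → Space d} {a b c : ℝ} (h₁ : IsPiecewiseC1 γ₁ a b)
    (h₂ : IsPiecewiseC1 γ₂ b c) (h : γ₁ b = γ₂ b) :
    IsPiecewiseC1 (fun s => if s ≤ b then γ₁ s else γ₂ s) a c := by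
  obtain ⟨n, t, ht, rfl, rfl, hγ⟩ := h₁
  obtain ⟨m, u, hu, hu0, rfl, hγ'⟩ := h₂
  refine ⟨n + m, fun i => if i ≤ n then t i else u (i - n), ?_, by simp, ?_, fun i hi => ?_⟩
  · refine monotone_nat_of_le_succ fun i => ?_
    rcases lt_trichotomy i n with hi | rfl | hi
    · simpa [hi.le, Nat.succ_le_of_lt hi] using ht i.le_succ
    · simpa [← hu0] using hu (Nat.zero_le 1)
    · simpa [hi.not_ge, (hi.trans i.lt_succ_self).not_ge] using hu (by omega : i - n ≤ i + 1 - n)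
  · rcases Nat.eq_zero_or_pos m with rfl | hm
    · simp [hu0]
    · simp [hm.ne']
  · rcases lt_or_ge i n with hi' | hi'
    · simp only [hi'.le, Nat.succ_le_of_lt hi', if_true]
      refine (hγ i hi').congr fun s hs => ?_
      simp [hs.2.trans (ht (Nat.succ_le_of_lt hi'))]
    · have e1 : (if i ≤ n then t i else u (i - n)) = u (i - n) := by
        split_ifs with h3
        · obtain rfl : i = n := le_antisymm h3 hi'
          simp [hu0]
        · rfl
      have e2 : (if i + 1 ≤ n then t (i + 1) else u (i + 1 - n)) = u (i - n + 1) := by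
        rw [if_neg (by omega)]; congr 1; omega
      simp only [e1, e2]
      refine (hγ' (i - n) (by omega)).congr fun s hs => ?_
      have hs' : t n ≤ s := hu0 ▸ (hu (Nat.zero_le _)).trans hs.1
      split_ifs with h4
      · obtain rfl : s = t n := le_antisymm h4 hs'
        exact h
      · rfl

lemma IsRegular.riemDist_triangle (hM : IsRegular M) (x y z : Space d) :
    riemDist M x z ≤ riemDist M x y + riemDist M y z := by
  refine le_of_forall_pos_lt_add fun ε hε => ?_
  obtain ⟨γ₁, a, b, rfl, hb, h₁, hl₁⟩ :=
    exists_path_lt M (lt_add_of_pos_right (riemDist M x y) (half_pos hε))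
  obtain ⟨γ₂, a', c, ha', rfl, h₂, hl₂⟩ :=
    exists_path_lt M (lt_add_of_pos_right (riemDist M y z) (half_pos hε))
  have h₂' := h₂.comp_sub (b - a')
  rw [← pathLength_comp_sub M γ₂ a' c (b - a')] at hl₂
  rw [add_sub_cancel] at h₂' hl₂
  set γ₃ := fun s => γ₂ (s - (b - a')) with hγ₃
  have hj : γ₁ b = γ₃ b := by simp [hγ₃, hb, ha']
  have hend : γ₃ (c + (b - a')) = γ₂ c := by simp [hγ₃]
  have hg := h₁.glue h₂' hj
  have hle := riemDist_le_pathLength M hg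
  have hc := h₂'.le
  simp only [h₁.le, if_true] at hle
  have e1 : Set.EqOn (fun s => if s ≤ b then γ₁ s else γ₃ s) γ₁ (Set.Ioo a b) :=
    fun s hs => if_pos hs.2.le
  have e2 : Set.EqOn (fun s => if s ≤ b then γ₁ s else γ₃ s) γ₃ (Set.Ioo b (c + (b - a'))) :=
    fun s hs => if_neg hs.1.not_ge
  have i1 := h₁.intervalIntegrable hM
  have i2 := h₂'.intervalIntegrable hM
  have f1 := length_integrand_eqOn M e1
  have f2 := length_integrand_eqOn M e2
  have i1' := i1.congr_uIoo (by rw [Set.uIoo_of_le h₁.le]; exact f1.symm)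
  have i2' := i2.congr_uIoo (by rw [Set.uIoo_of_le hc]; exact f2.symm)
  have e3 : (if c + (b - a') ≤ b then γ₁ (c + (b - a')) else γ₃ (c + (b - a'))) = γ₂ c := by
    split_ifs with h4
    · have : c + (b - a') = b := le_antisymm h4 hc
      rw [this, hj, ← this, hend]
    · exact hend
  rw [e3] at hle
  refine hle.trans_lt ?_
  have : pathLength M (fun s => if s ≤ b then γ₁ s else γ₃ s) a (c + (b - a'))
      = pathLength M γ₁ a b + pathLength M γ₃ b (c + (b - a')) := by
    unfold pathLength
    rw [← intervalIntegral.integral_add_adjacent_intervals i1' i2',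
      intervalIntegral.integral_congr_Ioo_of_le h₁.le f1,
      intervalIntegral.integral_congr_Ioo_of_le hc f2]
  linarith

lemma riemDist_translate (M : MatrixField d) (v x y : Space d) :
    riemDist (fun z => M (v + z)) x y = riemDist M (v + x) (v + y) := by
  have key : ∀ (M : MatrixField d) (v x y : Space d),
      riemDist M (v + x) (v + y) ≤ riemDist (fun z => M (v + z)) x y := by
    intro M v x y
    refine le_of_forall_gt fun r hr => ?_
    obtain ⟨γ, a, b, rfl, rfl, ⟨n, t, ht, rfl, rfl, hγ⟩, hlt⟩ := exists_path_lt _ hr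
    have hp : IsPiecewiseC1 (fun s => v + γ s) (t 0) (t n) :=
      ⟨n, t, ht, rfl, rfl, fun i hi => contDiffOn_const.add (hγ i hi)⟩
    refine (riemDist_le_pathLength M hp).trans_lt (lt_of_eq_of_lt ?_ hlt)
    simp only [pathLength, deriv_const_add]
  refine le_antisymm ?_ (key M v x y)
  simpa using key (fun z => M (v + z)) (-v) (v + x) (v + y)

end Geometry

section Polygons

variable {d : ℕ} {M : MatrixField d}

/-! ### Comparison with functions that are locally Lipschitz for the metric -/

lemma IsRegular.tendsto_segMean (hM : IsRegular M) {f u : ℝ → Space d} {l : Filter ℝ}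
    {p v : Space d} (hf : Tendsto f l (𝓝 p)) (hu : Tendsto u l (𝓝 v)) :
    Tendsto (fun z => segMean M p (f z) (u z)) l (𝓝 (matrixNorm (M p) v)) := by
  have h1 : Tendsto (fun z => (p, f z, u z)) l (𝓝 (p, p, v)) :=
    tendsto_const_nhds.prodMk_nhds (hf.prodMk_nhds hu)
  have h2 := (hM.continuous_segMean.tendsto (p, p, v)).comp h1
  rwa [segMean_self] at h2

/-- The increment of `F` along a smooth path is at most the length of the path, as soon as `F`
varies locally by no more than the lengths of straight segments: the right derivative of `F ∘ γ`
is at most the speed of `γ`. -/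
lemma IsRegular.sub_le_integral_speed (hM : IsRegular M) {F : Space d → ℝ}
    (hF : ∀ w, ∀ᶠ q in 𝓝 w, |F q - F w| ≤ segLength M w q) {γ : ℝ → Space d} {a b : ℝ}
    (hab : a ≤ b) (hγ : ContDiffOn ℝ 1 γ (Set.Icc a b)) :
    F (γ b) - F (γ a) ≤ ∫ s in a..b, matrixNorm (M (γ s)) (deriv γ s) := by
  rcases hab.eq_or_lt with rfl | hab'
  · simp
  have hFc : Continuous F := by
    refine continuous_iff_continuousAt.2 fun w => ?_
    refine tendsto_iff_dist_tendsto_zero.2 (squeeze_zero' (.of_forall fun _ => dist_nonneg)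
      (hF w) ?_)
    have : Tendsto (fun q => segLength M w q) (𝓝 w) (𝓝 (segLength M w w)) :=
      (hM.continuous_segLength.comp (by fun_prop : Continuous fun q => (w, q))).tendsto w
    rwa [segLength_self] at this
  obtain ⟨φ, hφ, hφ1, hφ2⟩ := exists_continuous_speed hM hab' hγ
  rw [← intervalIntegral.integral_congr_Ioo_of_le hab hφ2]
  have main : ∀ ε > 0, F (γ b) - F (γ a) ≤ (∫ s in a..b, φ s) + ε * (b - a) := by
    intro ε hε
    have h := image_le_of_liminf_slope_right_lt_deriv_boundary' (f := F ∘ γ) (f' := φ)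
      (B := fun s => F (γ a) + ((∫ u in a..s, φ u) + ε * (s - a))) (B' := fun s => φ s + ε)
      (a := a) (b := b) (hFc.comp_continuousOn hγ.continuousOn) ?_ (by simp) ?_ ?_
      (by intro s _ _; linarith) (Set.right_mem_Icc.2 hab)
    · simp only [Function.comp] at h
      linarith
    · intro s hs r hr
      refine Eventually.frequently ?_
      have hsI : s ∈ Set.Icc a b := Set.Ico_subset_Icc_self hs
      have hle : 𝓝[>] s ≤ 𝓝[Set.Icc a b \ {s}] s := by
        rw [← nhdsWithin_Ioc_eq_nhdsGT hs.2]
        exact nhdsWithin_mono _ fun z hz =>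
          ⟨⟨hs.1.trans hz.1.le, hz.2⟩, fun h => hz.1.ne' h⟩
      have hγc : Tendsto γ (𝓝[>] s) (𝓝 (γ s)) :=
        (hγ.continuousOn s hsI).mono_left (hle.trans (nhdsWithin_mono _ Set.sdiff_subset))
      have hd : HasDerivWithinAt γ (derivWithin γ (Set.Icc a b) s) (Set.Icc a b) s :=
        ((hγ.differentiableOn one_ne_zero) s hsI).hasDerivWithinAt
      have hsl := (hasDerivWithinAt_iff_tendsto_slope.1 hd).mono_left hle
      have hlim : Tendsto (fun z => segMean M (γ s) (γ z) (slope γ s z)) (𝓝[>] s) (𝓝 (φ s)) := by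
        rw [hφ1 s hsI]
        exact hM.tendsto_segMean hγc hsl
      filter_upwards [hlim.eventually_lt_const hr, hγc.eventually (hF (γ s)),
        self_mem_nhdsWithin] with z hz1 hz2 hz3
      have hpos : 0 < z - s := sub_pos.2 hz3
      refine lt_of_le_of_lt ?_ hz1
      rw [slope_def_field, slope_def_module, segMean_smul, abs_of_pos (inv_pos.2 hpos),
        div_eq_inv_mul]
      exact mul_le_mul_of_nonneg_left ((le_abs_self _).trans hz2) (inv_pos.2 hpos).le
    · have : Continuous fun s => ∫ u in a..s, φ u :=
        intervalIntegral.continuous_primitive (fun _ _ => hφ.intervalIntegrable _ _) a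
      exact (continuous_const.add (this.add (by fun_prop))).continuousOn
    · intro s _
      have h1 : HasDerivAt (fun s => ∫ u in a..s, φ u) (φ s) s :=
        intervalIntegral.integral_hasDerivAt_right (hφ.intervalIntegrable _ _)
          hφ.stronglyMeasurable.stronglyMeasurableAtFilter hφ.continuousAt
      have h2 : HasDerivAt (fun s : ℝ => ε * (s - a)) ε s := by
        simpa using ((hasDerivAt_id s).sub_const a).const_mul ε
      exact ((h1.add h2).const_add _).hasDerivWithinAt
  refine le_of_forall_pos_le_add fun ε hε => ?_
  have h := main (ε / (b - a)) (div_pos hε (sub_pos.2 hab'))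
  rwa [div_mul_cancel₀ _ (sub_pos.2 hab').ne'] at h

/-- A function that varies locally by no more than the lengths of straight segments is
`1`-Lipschitz for the distance. All lower bounds on the distance are obtained from it. -/
lemma IsRegular.sub_le_riemDist (hM : IsRegular M) {F : Space d → ℝ}
    (hF : ∀ w, ∀ᶠ q in 𝓝 w, |F q - F w| ≤ segLength M w q) (x y : Space d) :
    F y - F x ≤ riemDist M x y := by
  refine le_csInf (lengths_nonempty M x y) ?_
  rintro L ⟨γ, a, b, -, rfl, rfl, ⟨n, t, ht, rfl, rfl, hγ⟩, rfl⟩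
  have key : ∀ k ≤ n, F (γ (t k)) - F (γ (t 0)) ≤ pathLength M γ (t 0) (t k) := by
    intro k
    induction k with
    | zero => simp [pathLength]
    | succ k ih =>
      intro hk
      have h1 := ih (by omega)
      have h2 := hM.sub_le_integral_speed hF (ht k.le_succ) (hγ k hk)
      have h3 : IsPiecewiseC1 γ (t 0) (t k) := ⟨k, t, ht, rfl, rfl, fun i hi => hγ i (by omega)⟩
      have h4 := intervalIntegral.integral_add_adjacent_intervals (h3.intervalIntegrable hM)
        (intervalIntegrable_speed_of_contDiffOn hM (ht k.le_succ) (hγ k hk))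
      simp only [pathLength] at h1 ⊢
      linarith
  exact key n le_rfl

lemma IsRegular.abs_riemDist_sub_le (hM : IsRegular M) (x y z : Space d) :
    |riemDist M x z - riemDist M x y| ≤ riemDist M y z := by
  have h1 := hM.riemDist_triangle x y z
  have h2 := hM.riemDist_triangle x z y
  rw [riemDist_comm M z y] at h2
  exact abs_le.2 ⟨by linarith, by linarith⟩

/-- A path leaving a ball meets every sphere in between. -/
lemma IsRegular.exists_mem_sphere (hM : IsRegular M) (x : Space d) {p w : Space d} {r : ℝ}
    (hp : dist p x ≤ r) (hw : r ≤ dist w x) {ε : ℝ} (hε : 0 < ε) :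
    ∃ z, dist z x = r ∧ riemDist M p z + riemDist M z w ≤ riemDist M p w + ε := by
  -- inside the sphere `F` is the distance from `p`; outside it is the least length of a detour
  -- from `p` over the sphere
  let S := {z : Space d // dist z x = r}
  obtain ⟨z₀, hz₀⟩ : r ∈ Set.range fun z : Space d => dist z x :=
    mem_range_of_exists_le_of_exists_ge (by fun_prop) ⟨p, hp⟩ ⟨w, hw⟩
  have : Nonempty S := ⟨⟨z₀, hz₀⟩⟩
  let H : Space d → ℝ := fun q => ⨅ z : S, (riemDist M p z + riemDist M z q)
  have hbdd : ∀ q, BddBelow (Set.range fun z : S => riemDist M p z + riemDist M z q) := by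
    refine fun q => ⟨0, ?_⟩
    rintro _ ⟨z, rfl⟩
    exact add_nonneg (riemDist_nonneg _ _ _) (riemDist_nonneg _ _ _)
  have hHle : ∀ q q', H q' ≤ H q + riemDist M q q' := by
    intro q q'
    rw [← sub_le_iff_le_add]
    refine le_ciInf fun z => ?_
    have h1 := ciInf_le (hbdd q') z
    have h2 := hM.riemDist_triangle z q q'
    change H q' ≤ _ at h1
    linarith
  have hHabs : ∀ q q', |H q' - H q| ≤ riemDist M q q' := by
    intro q q'
    have h1 := hHle q q'
    have h2 := hHle q' q
    rw [riemDist_comm M q' q] at h2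
    exact abs_le.2 ⟨by linarith, by linarith⟩
  have hHS : ∀ q, dist q x = r → H q = riemDist M p q := by
    intro q hq
    refine le_antisymm ?_ (le_ciInf fun z => hM.riemDist_triangle _ _ _)
    have h := ciInf_le (hbdd q) ⟨q, hq⟩
    simpa [riemDist_self] using h
  let F : Space d → ℝ := fun q => if dist q x ≤ r then riemDist M p q else H q
  have hF' : ∀ q, r ≤ dist q x → F q = H q := by
    intro q hq
    simp only [F]
    split_ifs with h
    · exact (hHS q (le_antisymm h hq)).symm
    · rfl
  have hF : ∀ w, ∀ᶠ q in 𝓝 w, |F q - F w| ≤ segLength M w q := by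
    intro w
    suffices ∀ᶠ q in 𝓝 w, |F q - F w| ≤ riemDist M w q from
      this.mono fun q hq => hq.trans (riemDist_le_segLength M w q)
    have hin : ∀ q, dist w x ≤ r → dist q x ≤ r → |F q - F w| ≤ riemDist M w q := by
      intro q h1 h2
      simp only [F, if_pos h1, if_pos h2]
      exact hM.abs_riemDist_sub_le _ _ _
    have hout : ∀ q, r ≤ dist w x → r ≤ dist q x → |F q - F w| ≤ riemDist M w q := by
      intro q h1 h2
      rw [hF' _ h1, hF' _ h2]
      exact hHabs _ _
    have hcont : ContinuousAt (fun q : Space d => dist q x) w := by fun_prop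
    rcases lt_trichotomy (dist w x) r with h | h | h
    · filter_upwards [hcont.eventually_lt_const h] with q hq using hin q h.le hq.le
    · refine .of_forall fun q => ?_
      rcases le_total (dist q x) r with h' | h'
      · exact hin q h.le h'
      · exact hout q h.ge h'
    · filter_upwards [hcont.eventually_const_lt h] with q hq using hout q h.le hq.le
  have h := hM.sub_le_riemDist hF p w
  have h1 : F p = 0 := by simp only [F, if_pos hp, riemDist_self]
  rw [h1, hF' w hw, sub_zero] at h
  obtain ⟨z, hz⟩ := exists_lt_of_ciInf_lt (h.trans_lt (lt_add_of_pos_right _ hε))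
  exact ⟨z, z.2, hz.le⟩

/-- The distance from the inside of a ball to the outside of a larger one is positive. -/
lemma IsRegular.exists_pos_le_riemDist (hM : IsRegular M) (y : Space d) {r R : ℝ} (hr : r < R) :
    ∃ c > 0, ∀ p ∈ Metric.ball y r, ∀ q ∉ Metric.closedBall y R, c ≤ riemDist M p q := by
  obtain ⟨c, hc, hcM⟩ : ∃ c > 0, ∀ z ∈ Metric.closedBall y (R + 1), ∀ u : Space d,
      c * ‖u‖ ≤ matrixNorm (M z) u := by
    have hK : IsCompact (Metric.closedBall y (R + 1) ×ˢ Metric.sphere (0 : Space d) 1) :=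
      (isCompact_closedBall _ _).prod (isCompact_sphere _ _)
    have hcont : Continuous fun z : Space d × Space d => matrixNorm (M z.1) z.2 :=
      continuous_matrixNorm.comp ((hM.continuous.comp continuous_fst).prodMk continuous_snd)
    obtain ⟨c, hc, h⟩ := hK.exists_forall_le' (a := 0) hcont.continuousOn (by
      rintro ⟨z, u⟩ ⟨-, hu⟩
      exact matrixNorm_pos (hM.posDef z) (ne_zero_of_mem_unit_sphere ⟨u, hu⟩))
    refine ⟨c, hc, fun z hz u => ?_⟩
    rcases eq_or_ne u 0 with rfl | hu
    · simp [matrixNorm_zero]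
    have hu' : ‖u‖ ≠ 0 := norm_ne_zero_iff.2 hu
    have h1 := h (z, ‖u‖⁻¹ • u) ⟨hz, by simp [norm_smul, hu']⟩
    rw [matrixNorm_smul, abs_of_nonneg (inv_nonneg.2 (norm_nonneg u))] at h1
    calc c * ‖u‖ ≤ (‖u‖⁻¹ * matrixNorm (M z) u) * ‖u‖ :=
          mul_le_mul_of_nonneg_right h1 (norm_nonneg u)
      _ = matrixNorm (M z) u := by field_simp
  refine ⟨c * (R - r), mul_pos hc (sub_pos.2 hr), fun p hp q hq => ?_⟩
  let F : Space d → ℝ := fun w => c * min (dist w y) R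
  have hF : ∀ w, ∀ᶠ q in 𝓝 w, |F q - F w| ≤ segLength M w q := by
    intro w
    rcases lt_or_ge R (dist w y) with h | h
    · have hcont : ContinuousAt (fun q : Space d => dist q y) w := by fun_prop
      filter_upwards [hcont.eventually_const_lt h] with q hq
      simp only [F, min_eq_right hq.le, min_eq_right h.le, sub_self, abs_zero]
      exact segLength_nonneg _ _ _
    · filter_upwards [Metric.ball_mem_nhds w one_pos] with q hq
      have h1 : |F q - F w| ≤ c * ‖q - w‖ := by
        simp only [F]
        rw [← mul_sub, abs_mul, abs_of_pos hc]
        refine mul_le_mul_of_nonneg_left ?_ hc.le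
        refine (abs_min_sub_min_le_max _ _ _ _).trans ?_
        rw [sub_self, abs_zero, max_eq_left (abs_nonneg _), ← dist_eq_norm]
        exact abs_dist_sub_le _ _ _
      refine h1.trans ?_
      have hwc : w ∈ Metric.closedBall y (R + 1) :=
        Metric.mem_closedBall.2 (h.trans (by linarith))
      have hqc : q ∈ Metric.closedBall y (R + 1) := by
        have := dist_triangle q w y
        rw [Metric.mem_ball] at hq
        exact Metric.mem_closedBall.2 (by linarith)
      have hcont : Continuous fun s : ℝ => matrixNorm (M (w + s • (q - w))) (q - w) :=
        continuous_matrixNorm.comp ((hM.continuous.comp (by fun_prop)).prodMk continuous_const)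
      calc c * ‖q - w‖ = ∫ _ in (0 : ℝ)..1, c * ‖q - w‖ := by simp
        _ ≤ segLength M w q := by
          refine intervalIntegral.integral_mono_on zero_le_one
            intervalIntegrable_const (hcont.intervalIntegrable _ _) fun s hs => ?_
          refine hcM _ ?_ _
          exact (convex_closedBall y (R + 1)).add_smul_sub_mem hwc hqc hs
  have h := hM.sub_le_riemDist hF p q
  rw [Metric.mem_ball] at hp
  rw [Metric.mem_closedBall, not_le] at hq
  have h1 : F p ≤ c * r := mul_le_mul_of_nonneg_left ((min_le_left _ _).trans hp.le) hc.le
  have h2 : F q = c * R := by simp only [F, min_eq_right hq.le]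
  linarith

/-! ### Polygonal paths -/

/-- The length of the polygon with vertices `p`, `l`, `y`, in this order. -/
noncomputable def polyLength (M : MatrixField d) : Space d → List (Space d) → Space d → ℝ
  | p, [], y => segLength M p y
  | p, a :: l, y => segLength M p a + polyLength M a l y

/-- A countable dense set of points of `ℝ^d`. -/
def densePoints (d : ℕ) : Set (Space d) := Set.range (TopologicalSpace.denseSeq (Space d))

lemma dense_densePoints (d : ℕ) : Dense (densePoints d) := TopologicalSpace.denseRange_denseSeq _

lemma countable_densePoints (d : ℕ) : (densePoints d).Countable := Set.countable_range _

/-- The infimum of the lengths of the polygons from a point of `C` to `y` whose intermediate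
vertices lie in `U` and belong to the countable dense set `densePoints d`. -/
noncomputable def polyDist (M : MatrixField d) (C U : Set (Space d)) (y : Space d) : ℝ :=
  ⨅ i : C × List (U ∩ densePoints d : Set (Space d)), polyLength M i.1 (i.2.map (↑)) y

lemma polyLength_nonneg (M : MatrixField d) (p : Space d) (l : List (Space d)) (y : Space d) :
    0 ≤ polyLength M p l y := by
  induction l generalizing p with
  | nil => exact segLength_nonneg _ _ _
  | cons a l ih => exact add_nonneg (segLength_nonneg _ _ _) (ih a)

lemma polyLength_concat (M : MatrixField d) (p : Space d) (l : List (Space d)) (q y : Space d) :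
    polyLength M p (l ++ [q]) y = polyLength M p l q + segLength M q y := by
  induction l generalizing p with
  | nil => rfl
  | cons a l ih => simp only [List.cons_append, polyLength, ih, add_assoc]

lemma IsRegular.continuous_polyLength (hM : IsRegular M) (p : Space d) (l : List (Space d)) :
    Continuous (polyLength M p l) := by
  induction l generalizing p with
  | nil => exact hM.continuous_segLength.comp (by fun_prop : Continuous fun q => (p, q))
  | cons a l ih => exact continuous_const.add (ih a)

lemma IsRegular.riemDist_le_polyLength (hM : IsRegular M) (p : Space d) (l : List (Space d))
    (y : Space d) : riemDist M p y ≤ polyLength M p l y := by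
  induction l generalizing p with
  | nil => exact riemDist_le_segLength _ _ _
  | cons a l ih =>
    exact (hM.riemDist_triangle p a y).trans (add_le_add (riemDist_le_segLength _ _ _) (ih a))

section PolyDist

variable {C U : Set (Space d)}

lemma bddBelow_polyLength (M : MatrixField d) (C U : Set (Space d)) (y : Space d) :
    BddBelow (Set.range fun i : C × List (U ∩ densePoints d : Set (Space d)) =>
      polyLength M i.1 (i.2.map (↑)) y) := by
  refine ⟨0, ?_⟩
  rintro _ ⟨i, rfl⟩
  exact polyLength_nonneg _ _ _ _

lemma polyDist_le (M : MatrixField d) {p : Space d} (hp : p ∈ C)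
    (l : List (U ∩ densePoints d : Set (Space d))) (y : Space d) :
    polyDist M C U y ≤ polyLength M p (l.map (↑)) y :=
  ciInf_le (bddBelow_polyLength M C U y) (⟨p, hp⟩, l)

lemma exists_polyLength_lt (hC : C.Nonempty) {y : Space d} {r : ℝ} (h : polyDist M C U y < r) :
    ∃ p ∈ C, ∃ l : List (U ∩ densePoints d : Set (Space d)), polyLength M p (l.map (↑)) y < r := by
  have : Nonempty C := hC.to_subtype
  obtain ⟨⟨p, l⟩, h⟩ := exists_lt_of_ciInf_lt h
  exact ⟨p, p.2, l, h⟩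

lemma IsRegular.polyDist_le_add (hM : IsRegular M) (hC : C.Nonempty) (hU : IsOpen U)
    {y z : Space d} (hy : y ∈ U) : polyDist M C U z ≤ polyDist M C U y + segLength M y z := by
  refine le_of_forall_pos_lt_add fun ε hε => ?_
  obtain ⟨p, hp, l, hl⟩ := exists_polyLength_lt hC (lt_add_of_pos_right (polyDist M C U y) hε)
  -- the vertex `y` may be moved to a nearby point of the dense set
  have hcont : Continuous fun q => polyLength M p (l.map (↑)) q + segLength M q z :=
    (hM.continuous_polyLength p _).add
      (hM.continuous_segLength.comp (by fun_prop : Continuous fun q => (q, z)))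
  have hopen : IsOpen ({q | polyLength M p (l.map (↑)) q + segLength M q z
      < polyDist M C U y + segLength M y z + ε} ∩ U) :=
    (isOpen_lt hcont continuous_const).inter hU
  obtain ⟨q, hq, hqU⟩ := (dense_densePoints d).exists_mem_open hopen
    ⟨y, by simp only [Set.mem_ofPred_eq]; linarith, hy⟩
  refine (polyDist_le M hp (l ++ [⟨q, hqU.2, hq⟩]) z).trans_lt ?_
  rw [List.map_append, List.map_singleton, polyLength_concat]
  exact hqU.1

lemma IsRegular.abs_polyDist_sub_le (hM : IsRegular M) (hC : C.Nonempty) (hU : IsOpen U)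
    {y z : Space d} (hy : y ∈ U) (hz : z ∈ U) :
    |polyDist M C U z - polyDist M C U y| ≤ segLength M y z := by
  have h1 := hM.polyDist_le_add (z := z) hC hU hy
  have h2 := hM.polyDist_le_add (z := y) hC hU hz
  rw [segLength_comm M z y] at h2
  exact abs_le.2 ⟨by linarith, by linarith⟩

/-- Polygons with vertices in a countable dense set are enough to compute the distance. -/
lemma IsRegular.riemDist_eq_polyDist (hM : IsRegular M) (x y : Space d) :
    riemDist M x y = polyDist M {x} Set.univ y := by
  have hC : ({x} : Set (Space d)).Nonempty := Set.singleton_nonempty x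
  refine le_antisymm ?_ ?_
  · have := hC.to_subtype
    refine le_ciInf fun i => ?_
    have h := hM.riemDist_le_polyLength i.1 (i.2.map (↑)) y
    rwa [(i.1.2 : (i.1 : Space d) = x)] at h ⊢
  · have h := hM.sub_le_riemDist (F := polyDist M {x} Set.univ) (fun w => .of_forall fun q =>
      hM.abs_polyDist_sub_le hC isOpen_univ (Set.mem_univ _) (Set.mem_univ _)) x y
    have h0 : polyDist M {x} Set.univ x ≤ 0 :=
      (polyDist_le M (Set.mem_singleton x) [] x).trans_eq (segLength_self M x)
    linarith

/-- If no polygon inside the open set `U` leads in length less than `t` from `C` out of the closed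
set `K ⊆ U`, then no path does, whether it stays in `U` or not. -/
lemma IsRegular.le_riemDist_of_polyDist (hM : IsRegular M) {O K : Set (Space d)} (hO : IsOpen O)
    (hOK : O ⊆ K) (hK : IsClosed K) (hKU : K ⊆ U) (hU : IsOpen U) {t : ℝ}
    (h : ∀ q ∈ U \ K, q ∈ densePoints d → t ≤ polyDist M (O ∩ densePoints d) U q)
    {p q : Space d} (hp : p ∈ O) (hq : q ∉ K) : t ≤ riemDist M p q := by
  have hC : (O ∩ densePoints d).Nonempty := by
    obtain ⟨z, hz, hzO⟩ := (dense_densePoints d).exists_mem_open hO ⟨p, hp⟩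
    exact ⟨z, hzO, hz⟩
  have h' : ∀ z ∈ U \ K, t ≤ polyDist M (O ∩ densePoints d) U z := by
    intro z hz
    by_contra! hlt
    obtain ⟨p', hp', l, hl⟩ := exists_polyLength_lt hC hlt
    have hopen : IsOpen ({z | polyLength M p' (l.map (↑)) z < t} ∩ (U \ K)) :=
      (isOpen_lt (hM.continuous_polyLength p' _) continuous_const).inter (hU.sdiff hK)
    obtain ⟨z', hz', hz'U⟩ := (dense_densePoints d).exists_mem_open hopen ⟨z, hl, hz⟩
    exact absurd hz'U.1 (not_lt.2 ((h z' hz'U.2 hz').trans (polyDist_le M hp' l z')))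
  classical
  -- comparison with the polygonal distance from `O`, capped at the level `t` it reaches off `K`
  let F : Space d → ℝ := fun z => if z ∈ K then min (polyDist M (O ∩ densePoints d) U z) t else t
  have hFU : ∀ z ∈ U, F z = min (polyDist M (O ∩ densePoints d) U z) t := by
    intro z hz
    simp only [F]
    split_ifs with hzK
    · rfl
    · exact (min_eq_right (h' z ⟨hz, hzK⟩)).symm
  have hF : ∀ w, ∀ᶠ q in 𝓝 w, |F q - F w| ≤ segLength M w q := by
    intro w
    by_cases hw : w ∈ K
    · filter_upwards [hU.mem_nhds (hKU hw)] with z hz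
      rw [hFU _ hz, hFU _ (hKU hw)]
      refine (abs_min_sub_min_le_max _ _ _ _).trans ?_
      rw [sub_self, abs_zero, max_eq_left (abs_nonneg _)]
      exact hM.abs_polyDist_sub_le hC hU (hKU hw) hz
    · filter_upwards [hK.isOpen_compl.mem_nhds hw] with z hz
      simp only [F, if_neg hw, if_neg hz, sub_self, abs_zero]
      exact segLength_nonneg _ _ _
  have hp0 : polyDist M (O ∩ densePoints d) U p ≤ 0 := by
    refine le_of_forall_pos_lt_add fun ε hε => ?_
    have hopen : IsOpen ({z | segLength M z p < 0 + ε} ∩ O) :=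
      (isOpen_lt (hM.continuous_segLength.comp (by fun_prop : Continuous fun q => (q, p)))
        continuous_const).inter hO
    obtain ⟨z, hz, hzO⟩ := (dense_densePoints d).exists_mem_open hopen
      ⟨p, by simpa [segLength_self] using hε, hp⟩
    exact (polyDist_le M (show z ∈ O ∩ densePoints d from ⟨hzO.2, hz⟩) [] p).trans_lt hzO.1
  have hfin := hM.sub_le_riemDist hF p q
  have h1 : F q = t := if_neg hq
  have h2 : F p ≤ 0 := by
    rw [hFU p (hKU (hOK hp))]
    exact (min_le_left _ _).trans hp0
  linarith

end PolyDist

end Polygons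

section Measurability

variable {d : ℕ} {M : MatrixField d}

/-! ### Measurability of the distance -/

/-- Left Riemann sums over equal subdivisions of `[0, 1]` converge to the integral. -/
lemma tendsto_riemannSum {f : ℝ → ℝ} (hf : Continuous f) :
    Tendsto (fun n : ℕ => (n : ℝ)⁻¹ * ∑ k ∈ Finset.range n, f (k / n)) atTop
      (𝓝 (∫ s in (0 : ℝ)..1, f s)) := by
  rw [Metric.tendsto_atTop]
  intro ε hε
  obtain ⟨δ, hδ, h⟩ := Metric.uniformContinuousOn_iff.1
    ((isCompact_Icc (a := (0 : ℝ)) (b := 1)).uniformContinuousOn_of_continuous hf.continuousOn)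
    (ε / 2) (half_pos hε)
  obtain ⟨N, hN⟩ := exists_nat_gt δ⁻¹
  refine ⟨N + 1, fun n hn => ?_⟩
  have hn0 : (0 : ℝ) < n := by exact_mod_cast (by omega : 0 < n)
  have hnδ : (n : ℝ)⁻¹ < δ := by
    rw [inv_lt_comm₀ hn0 hδ]
    exact hN.trans_le (by exact_mod_cast (by omega : N ≤ n))
  have hsum : ∑ k ∈ Finset.range n, ∫ s in ((k : ℝ) / n)..((k + 1 : ℕ) : ℝ) / n, f s
      = ∫ s in (0 : ℝ)..1, f s := by
    rw [intervalIntegral.sum_integral_adjacent_intervals (a := fun k : ℕ => (k : ℝ) / n)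
      fun k _ => hf.intervalIntegrable _ _]
    simp [hn0.ne']
  have hlen : ∀ k : ℕ, ((k + 1 : ℕ) : ℝ) / n - k / n = (n : ℝ)⁻¹ := by
    intro k; push_cast; field_simp; ring
  rw [dist_eq_norm, ← hsum, Finset.mul_sum, ← Finset.sum_sub_distrib]
  have hterm : ∀ k ∈ Finset.range n, ‖(n : ℝ)⁻¹ * f (k / n)
      - ∫ s in ((k : ℝ) / n)..((k + 1 : ℕ) : ℝ) / n, f s‖ ≤ ε / 2 * (n : ℝ)⁻¹ := by
    intro k hk
    have hk' : k + 1 ≤ n := Finset.mem_range.1 hk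
    have hle : (k : ℝ) / n ≤ ((k + 1 : ℕ) : ℝ) / n := by
      have := hlen k
      have := inv_pos.2 hn0
      linarith
    have e : (n : ℝ)⁻¹ * f (k / n) - ∫ s in ((k : ℝ) / n)..((k + 1 : ℕ) : ℝ) / n, f s
        = ∫ s in ((k : ℝ) / n)..((k + 1 : ℕ) : ℝ) / n, (f (k / n) - f s) := by
      rw [intervalIntegral.integral_sub intervalIntegrable_const (hf.intervalIntegrable _ _),
        intervalIntegral.integral_const, hlen, smul_eq_mul]
    rw [e]
    have hb := intervalIntegral.norm_integral_le_of_norm_le_const (C := ε / 2)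
      (f := fun s => f (k / n) - f s) (a := (k : ℝ) / n) (b := ((k + 1 : ℕ) : ℝ) / n) ?_
    · rwa [hlen, abs_of_pos (inv_pos.2 hn0)] at hb
    · intro s hs
      rw [Set.uIoc_of_le hle] at hs
      have h0 : (0 : ℝ) ≤ (k : ℝ) / n := by positivity
      have h1 : ((k + 1 : ℕ) : ℝ) / n ≤ 1 := by
        rw [div_le_one hn0]; exact_mod_cast hk'
      have hd := h (k / n) ⟨h0, hle.trans h1⟩ s ⟨h0.trans hs.1.le, hs.2.trans h1⟩ (by
        rw [dist_comm, Real.dist_eq, abs_of_pos (sub_pos.2 hs.1)]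
        have := hlen k
        linarith [hs.2])
      rw [← dist_eq_norm]
      exact hd.le
  refine (norm_sum_le_of_le _ hterm).trans_lt ?_
  rw [Finset.sum_const, Finset.card_range, nsmul_eq_mul]
  have : (n : ℝ) * (ε / 2 * (n : ℝ)⁻¹) = ε / 2 := by field_simp
  linarith

/-- The `n`-th Riemann sum of the length of the segment from `x` to `y`. -/
noncomputable def segSum (M : MatrixField d) (x y : Space d) (n : ℕ) : ℝ :=
  (n : ℝ)⁻¹ * ∑ k ∈ Finset.range n, matrixNorm (M (x + ((k : ℝ) / n) • (y - x))) (y - x)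

/-- A version of `segLength` which is measurable on the space of all matrix fields: it reads the
field at countably many points only. The two agree for regular fields. The same holds for
`polyLimLength`, `polyLimDist` and `limDist` below. -/
noncomputable def segLimLength (M : MatrixField d) (x y : Space d) : ℝ :=
  liminf (segSum M x y) atTop

/-- The measurable version of `polyLength`. -/
noncomputable def polyLimLength (M : MatrixField d) : Space d → List (Space d) → Space d → ℝ
  | p, [], y => segLimLength M p y
  | p, a :: l, y => segLimLength M p a + polyLimLength M a l y

/-- The measurable version of `polyDist`. -/
noncomputable def polyLimDist (M : MatrixField d) (C U : Set (Space d)) (y : Space d) : ℝ :=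
  ⨅ i : C × List (U ∩ densePoints d : Set (Space d)), polyLimLength M i.1 (i.2.map (↑)) y

/-- The measurable version of `riemDist`. -/
noncomputable def limDist (M : MatrixField d) (x y : Space d) : ℝ := polyLimDist M {x} Set.univ y

lemma IsRegular.tendsto_segSum (hM : IsRegular M) (x y : Space d) :
    Tendsto (segSum M x y) atTop (𝓝 (segLength M x y)) :=
  tendsto_riemannSum (f := fun s => matrixNorm (M (x + s • (y - x))) (y - x))
    (continuous_matrixNorm.comp ((hM.continuous.comp (by fun_prop)).prodMk continuous_const))

lemma IsRegular.segLimLength_eq (hM : IsRegular M) (x y : Space d) :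
    segLimLength M x y = segLength M x y := (hM.tendsto_segSum x y).liminf_eq

lemma IsRegular.polyLimLength_eq (hM : IsRegular M) (p : Space d) (l : List (Space d))
    (y : Space d) : polyLimLength M p l y = polyLength M p l y := by
  induction l generalizing p with
  | nil => exact hM.segLimLength_eq _ _
  | cons a l ih => simp only [polyLimLength, polyLength, hM.segLimLength_eq, ih]

lemma IsRegular.polyLimDist_eq (hM : IsRegular M) (C U : Set (Space d)) (y : Space d) :
    polyLimDist M C U y = polyDist M C U y := by
  simp only [polyLimDist, polyDist, hM.polyLimLength_eq]

lemma IsRegular.limDist_eq (hM : IsRegular M) (x y : Space d) :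
    limDist M x y = riemDist M x y := by
  rw [limDist, hM.polyLimDist_eq, hM.riemDist_eq_polyDist]

lemma measurable_matrixNorm (v : Space d) :
    Measurable fun A : Matrix (Fin d) (Fin d) ℝ => matrixNorm A v := by
  have : BorelSpace (Matrix (Fin d) (Fin d) ℝ) := inferInstanceAs (BorelSpace (Fin d → Fin d → ℝ))
  exact (continuous_matrixNorm.comp (continuous_id.prodMk continuous_const)).measurable

section

variable {Ω : Type*} {m : MeasurableSpace Ω} {g : Ω → MatrixField d} {A C U : Set (Space d)}

lemma measurable_segSum (hA : Convex ℝ A) (hg : ∀ x ∈ A, Measurable fun ω => g ω x)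
    {x y : Space d} (hx : x ∈ A) (hy : y ∈ A) (n : ℕ) :
    Measurable fun ω => segSum (g ω) x y n := by
  refine (Finset.measurable_fun_sum _ fun k hk => ?_).const_mul _
  refine (measurable_matrixNorm _).comp (hg _ ?_)
  have hkn : (k : ℝ) ≤ n := by exact_mod_cast (Finset.mem_range.1 hk).le
  exact hA.add_smul_sub_mem hx hy ⟨by positivity, div_le_one_of_le₀ hkn (Nat.cast_nonneg n)⟩

lemma measurable_polyLimLength (hA : Convex ℝ A) (hg : ∀ x ∈ A, Measurable fun ω => g ω x)
    {p : Space d} (hp : p ∈ A) {l : List (Space d)} (hl : ∀ a ∈ l, a ∈ A) {y : Space d}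
    (hy : y ∈ A) : Measurable fun ω => polyLimLength (g ω) p l y := by
  have hseg : ∀ x ∈ A, ∀ y ∈ A, Measurable fun ω => segLimLength (g ω) x y :=
    fun x hx y hy => Measurable.liminf fun n => measurable_segSum hA hg hx hy n
  induction l generalizing p with
  | nil => exact hseg p hp y hy
  | cons a l ih =>
    have ha : a ∈ A := hl a (by simp)
    exact (hseg p hp a ha).add (ih ha fun b hb => hl b (by simp [hb]))

lemma measurable_polyLimDist (hA : Convex ℝ A) (hg : ∀ x ∈ A, Measurable fun ω => g ω x)
    (hC : C.Countable) (hCA : C ⊆ A) (hUA : U ⊆ A) {y : Space d} (hy : y ∈ A) :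
    Measurable fun ω => polyLimDist (g ω) C U y := by
  have := hC.to_subtype
  have : Countable (U ∩ densePoints d : Set (Space d)) :=
    ((countable_densePoints d).mono Set.inter_subset_right).to_subtype
  refine Measurable.iInf fun i => measurable_polyLimLength hA hg (hCA i.1.2) (fun a ha => ?_) hy
  obtain ⟨b, -, rfl⟩ := List.mem_map.1 ha
  exact hUA b.2.1

end

lemma measurable_limDist (x y : Space d) : Measurable fun M : MatrixField d => limDist M x y :=
  measurable_polyLimDist (g := fun M : MatrixField d => M) convex_univ
    (fun x _ => measurable_pi_apply x) (Set.countable_singleton x) (Set.subset_univ _)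
    (Set.subset_univ _) (Set.mem_univ _)

/-! ### Stationarity and moments -/

section Random

variable {Ω : Type*} [MeasurableSpace Ω] {P : Measure Ω} {g : Ω → MatrixField d}

lemma IsRegular.translate (hM : IsRegular M) (v : Space d) : IsRegular fun x => M (v + x) :=
  ⟨hM.continuous.comp (by fun_prop), fun _ => hM.posDef _⟩

lemma IsRandomMetric.measurable_field (hg : IsRandomMetric g) : Measurable g :=
  measurable_pi_iff.2 hg.measurable

lemma IsRandomMetric.measurable_translate (hg : IsRandomMetric g) (v : Space d) :
    Measurable fun ω x => g ω (v + x) := measurable_pi_iff.2 fun _ => hg.measurable _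

lemma IsErgodicField.identDistrib (herg : IsErgodicField g P) (hg : IsRandomMetric g)
    (v : Space d) : ProbabilityTheory.IdentDistrib (fun ω x => g ω (v + x)) g P P :=
  ⟨(hg.measurable_translate v).aemeasurable, hg.measurable_field.aemeasurable, herg.stationary v⟩

/-- The joint law of any family of distances is invariant under translations. -/
lemma IsErgodicField.identDistrib_riemDist (herg : IsErgodicField g P) (hg : IsRandomMetric g)
    (hreg : ∀ᵐ ω ∂P, IsRegular (g ω)) (v : Space d) {ι : Type*} (x y : ι → Space d) :
    ProbabilityTheory.IdentDistrib (fun ω i => riemDist (g ω) (v + x i) (v + y i))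
      (fun ω i => riemDist (g ω) (x i) (y i)) P P := by
  have hΦ : Measurable fun (M : MatrixField d) i => limDist M (x i) (y i) :=
    measurable_pi_iff.2 fun i => measurable_limDist _ _
  have h := (herg.identDistrib hg v).comp hΦ
  have e1 : (fun ω i => limDist (fun z => g ω (v + z)) (x i) (y i))
      =ᵐ[P] fun ω i => riemDist (g ω) (v + x i) (v + y i) := by
    filter_upwards [hreg] with ω hω
    ext i
    rw [(hω.translate v).limDist_eq, riemDist_translate]
  have e2 : (fun ω i => limDist (g ω) (x i) (y i))
      =ᵐ[P] fun ω i => riemDist (g ω) (x i) (y i) := by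
    filter_upwards [hreg] with ω hω
    ext i
    rw [hω.limDist_eq]
  exact ((ProbabilityTheory.IdentDistrib.of_ae_eq h.aemeasurable_fst e1).symm.trans h).trans
    (ProbabilityTheory.IdentDistrib.of_ae_eq h.aemeasurable_snd e2)

lemma aemeasurable_riemDist (hg : IsRandomMetric g) (hreg : ∀ᵐ ω ∂P, IsRegular (g ω))
    (x y : Space d) : AEMeasurable (fun ω => riemDist (g ω) x y) P := by
  refine AEMeasurable.congr
    ((measurable_limDist x y).comp hg.measurable_field).aemeasurable ?_
  filter_upwards [hreg] with ω hω using hω.limDist_eq x y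

lemma IsErgodicField.identDistrib_matrixNorm (herg : IsErgodicField g P) (hg : IsRandomMetric g)
    (x v : Space d) :
    ProbabilityTheory.IdentDistrib (fun ω => matrixNorm (g ω x) v)
      (fun ω => matrixNorm (g ω 0) v) P P := by
  have h := (herg.identDistrib hg x).comp
    (u := fun M : MatrixField d => matrixNorm (M 0) v)
    ((measurable_matrixNorm v).comp (measurable_pi_apply 0))
  simpa [Function.comp_def] using h

/-- The mean distance is at most the mean length of the segment, by Fatou's lemma applied to
Riemann sums. -/
lemma IsErgodicField.lintegral_riemDist_le (herg : IsErgodicField g P) (hg : IsRandomMetric g)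
    (hreg : ∀ᵐ ω ∂P, IsRegular (g ω))
    (hmoment : ∀ v : Space d, Integrable (fun ω => matrixNorm (g ω 0) v) P) (x y : Space d) :
    ∫⁻ ω, ENNReal.ofReal (riemDist (g ω) x y) ∂P
      ≤ ENNReal.ofReal (∫ ω, matrixNorm (g ω 0) (y - x) ∂P) := by
  have hint : ∀ z, Integrable (fun ω => matrixNorm (g ω z) (y - x)) P := fun z =>
    (herg.identDistrib_matrixNorm hg z (y - x)).integrable_iff.2 (hmoment _)
  have hmean : ∀ z, ∫ ω, matrixNorm (g ω z) (y - x) ∂P = ∫ ω, matrixNorm (g ω 0) (y - x) ∂P :=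
    fun z => (herg.identDistrib_matrixNorm hg z (y - x)).integral_eq
  have hsum : ∀ n : ℕ, 0 < n → ∫⁻ ω, ENNReal.ofReal (segSum (g ω) x y n) ∂P
      = ENNReal.ofReal (∫ ω, matrixNorm (g ω 0) (y - x) ∂P) := by
    intro n hn
    have hn' : (n : ℝ) ≠ 0 := by exact_mod_cast hn.ne'
    have hI : Integrable (fun ω => segSum (g ω) x y n) P :=
      (integrable_finsetSum _ fun k _ => hint _).const_mul _
    rw [← ofReal_integral_eq_lintegral_ofReal hI (.of_forall fun ω => mul_nonneg
      (by positivity) (Finset.sum_nonneg fun _ _ => matrixNorm_nonneg _ _))]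
    congr 1
    simp only [segSum]
    rw [integral_const_mul, integral_finsetSum _ fun k _ => hint _]
    simp only [hmean, Finset.sum_const, Finset.card_range, nsmul_eq_mul]
    field_simp
  calc ∫⁻ ω, ENNReal.ofReal (riemDist (g ω) x y) ∂P
      ≤ ∫⁻ ω, liminf (fun n => ENNReal.ofReal (segSum (g ω) x y n)) atTop ∂P := by
        refine lintegral_mono_ae ?_
        filter_upwards [hreg] with ω hω
        have h := (ENNReal.continuous_ofReal.tendsto _).comp (hω.tendsto_segSum x y)
        rw [Function.comp_def] at h
        rw [h.liminf_eq]
        exact ENNReal.ofReal_le_ofReal (riemDist_le_segLength _ _ _)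
    _ ≤ liminf (fun n => ∫⁻ ω, ENNReal.ofReal (segSum (g ω) x y n) ∂P) atTop :=
        lintegral_liminf_le fun n => ENNReal.measurable_ofReal.comp
          (measurable_segSum convex_univ (fun z _ => hg.measurable z) (Set.mem_univ _)
            (Set.mem_univ _) n)
    _ = ENNReal.ofReal (∫ ω, matrixNorm (g ω 0) (y - x) ∂P) := by
        refine (tendsto_const_nhds.congr' ?_).liminf_eq
        filter_upwards [eventually_gt_atTop 0] with n hn using (hsum n hn).symm

lemma IsErgodicField.integrable_riemDist (herg : IsErgodicField g P) (hg : IsRandomMetric g)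
    (hreg : ∀ᵐ ω ∂P, IsRegular (g ω))
    (hmoment : ∀ v : Space d, Integrable (fun ω => matrixNorm (g ω 0) v) P) (x y : Space d) :
    Integrable (fun ω => riemDist (g ω) x y) P := by
  refine ⟨(aemeasurable_riemDist hg hreg x y).aestronglyMeasurable, ?_⟩
  rw [hasFiniteIntegral_iff_ofReal (.of_forall fun ω => riemDist_nonneg _ _ _)]
  exact (herg.lintegral_riemDist_le hg hreg hmoment x y).trans_lt ENNReal.ofReal_lt_top

lemma IsErgodicField.integral_riemDist_le (herg : IsErgodicField g P) (hg : IsRandomMetric g)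
    (hreg : ∀ᵐ ω ∂P, IsRegular (g ω))
    (hmoment : ∀ v : Space d, Integrable (fun ω => matrixNorm (g ω 0) v) P) (x y : Space d) :
    ∫ ω, riemDist (g ω) x y ∂P ≤ ∫ ω, matrixNorm (g ω 0) (y - x) ∂P := by
  have h := herg.lintegral_riemDist_le hg hreg hmoment x y
  rw [← ofReal_integral_eq_lintegral_ofReal (herg.integrable_riemDist hg hreg hmoment x y)
    (.of_forall fun ω => riemDist_nonneg _ _ _)] at h
  exact (ENNReal.ofReal_le_ofReal_iff (integral_nonneg fun _ => matrixNorm_nonneg _ _)).1 h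

end Random

end Measurability

section Subadditive

/-! ### Means of stationary subadditive sequences -/

/-- From a time `k` that starts a block of at most `N` steps and of cost at most `c` per step, jump
over that block; otherwise take one step. Only the latter steps cost more than `c`. -/
lemma le_mul_add_sum_of_blocks {D : ℕ → ℕ → ℝ} {w : ℕ → ℝ} {c : ℝ} (N : ℕ) (h0 : ∀ i, D i i = 0)
    (hsub : ∀ i j k, i ≤ j → j ≤ k → D i k ≤ D i j + D j k) (hw : ∀ i, 0 ≤ w i)
    (hstep : ∀ i, D i (i + 1) ≤ c + w i) (good : ℕ → Prop) [DecidablePred good]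
    (hgood : ∀ k, good k → ∃ n, 1 ≤ n ∧ n ≤ N ∧ D k (k + n) ≤ n * c) (j : ℕ) :
    ∀ m i, i + m = j → D i j ≤ m * c
      + ∑ k ∈ Finset.Ico i j, if good k ∧ k + N < j then 0 else w k := by
  have hnn : ∀ k, 0 ≤ if good k ∧ k + N < j then 0 else w k := fun k => by
    split_ifs
    exacts [le_rfl, hw k]
  intro m
  induction m using Nat.strong_induction_on with
  | _ m ih =>
    intro i him
    rcases Nat.eq_zero_or_pos m with rfl | hm
    · obtain rfl : i = j := him
      simp [h0]
    by_cases hi : good i ∧ i + N < j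
    · obtain ⟨n, hn1, hnN, hn⟩ := hgood i hi.1
      have h1 := ih (m - n) (by omega) (i + n) (by omega)
      have h2 := hsub i (i + n) j (by omega) (by omega)
      rw [← Finset.sum_Ico_consecutive _ (by omega : i ≤ i + n) (by omega : i + n ≤ j)]
      have h3 : 0 ≤ ∑ k ∈ Finset.Ico i (i + n), if good k ∧ k + N < j then 0 else w k :=
        Finset.sum_nonneg fun k _ => hnn k
      have h4 : ((m - n : ℕ) : ℝ) * c = m * c - n * c := by
        rw [Nat.cast_sub (by omega)]; ring
      linarith
    · have h1 := ih (m - 1) (by omega) (i + 1) (by omega)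
      have h2 := hsub i (i + 1) j (by omega) (by omega)
      rw [Finset.sum_eq_sum_Ico_succ_bot (by omega : i < j), if_neg hi]
      have h4 : ((m - 1 : ℕ) : ℝ) * c = m * c - c := by
        rw [Nat.cast_sub hm]; push_cast; ring
      have := hstep i
      linarith

variable {Ω : Type*} [MeasurableSpace Ω] {P : Measure Ω} [IsProbabilityMeasure P]

/-- Let `D` be a subadditive process whose rows `n ↦ D k (k + n)` all have the same law. If almost
surely some block `[0, n)` costs at most `c` per step, then the asymptotic mean cost per step is at
most `c`. This replaces the pointwise ergodic theorem. -/
lemma le_of_ae_exists_block_le {D : ℕ → ℕ → Ω → ℝ} {c γ : ℝ}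
    (hint : ∀ n, Integrable (D 0 n) P) (h0 : ∀ i ω, D i i ω = 0)
    (hsub : ∀ᵐ ω ∂P, ∀ i j k, i ≤ j → j ≤ k → D i k ω ≤ D i j ω + D j k ω)
    (hstat : ∀ k, ProbabilityTheory.IdentDistrib (fun ω n => D k (k + n) ω)
      (fun ω n => D 0 n ω) P P)
    (hγ : ∀ n : ℕ, n * γ ≤ ∫ ω, D 0 n ω ∂P)
    (hex : ∀ᵐ ω ∂P, ∃ n, 1 ≤ n ∧ D 0 n ω ≤ n * c) : γ ≤ c := by
  classical
  -- `good N x`: the row `x` starts with a block of at most `N` steps and cost at most `c` per step;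
  -- `ψ` bounds the excess cost of a single step, and `φ N` is that excess where no block is used
  let good : ℕ → (ℕ → ℝ) → Prop := fun N x => ∃ n, 1 ≤ n ∧ n ≤ N ∧ x n ≤ n * c
  let ψ : (ℕ → ℝ) → ℝ := fun x => |x 1| + |c|
  let φ : ℕ → (ℕ → ℝ) → ℝ := fun N x => if good N x then 0 else ψ x
  have hψ : Measurable ψ := by
    have : Measurable fun x : ℕ → ℝ => x 1 := measurable_pi_apply 1
    exact this.norm.add_const _
  have hφ : ∀ N, Measurable (φ N) := by
    intro N
    refine Measurable.ite ?_ measurable_const hψ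
    have : {x | good N x} = ⋃ n ∈ Set.Icc 1 N, {x : ℕ → ℝ | x n ≤ n * c} := by
      ext x; simp [good, and_assoc]
    rw [this]
    exact MeasurableSet.biUnion (Set.to_countable _) fun n _ =>
      measurableSet_le (measurable_pi_apply n) measurable_const
  have hψ0 : ∀ x, 0 ≤ ψ x := fun x => add_nonneg (abs_nonneg _) (abs_nonneg _)
  have hφ0 : ∀ N x, 0 ≤ φ N x := fun N x => by
    simp only [φ]; split_ifs; exacts [le_rfl, hψ0 x]
  have hφψ : ∀ N x, φ N x ≤ ψ x := fun N x => by
    simp only [φ]; split_ifs; exacts [hψ0 x, le_rfl]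
  let row : ℕ → Ω → ℕ → ℝ := fun k ω n => D k (k + n) ω
  have hrow0 : (fun ω n => D 0 n ω) = row 0 := by ext ω n; simp [row]
  rw [hrow0] at hstat
  have hψint0 : Integrable (fun ω => ψ (row 0 ω)) P := by
    simp only [row, ψ, zero_add]
    exact (hint 1).abs.add (integrable_const _)
  have hφint0 : ∀ N, Integrable (fun ω => φ N (row 0 ω)) P := fun N =>
    hψint0.mono' ((hφ N).comp_aemeasurable (hstat 0).aemeasurable_fst).aestronglyMeasurable
      (.of_forall fun ω => by
        rw [Real.norm_eq_abs, abs_of_nonneg (hφ0 _ _)]; exact hφψ _ _)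
  have hψk : ∀ k,
      ProbabilityTheory.IdentDistrib (fun ω => ψ (row k ω)) (fun ω => ψ (row 0 ω)) P P :=
    fun k => (hstat k).comp hψ
  have hφk : ∀ N k,
      ProbabilityTheory.IdentDistrib (fun ω => φ N (row k ω)) (fun ω => φ N (row 0 ω)) P P :=
    fun N k => (hstat k).comp (hφ N)
  set e : ℕ → ℝ := fun N => ∫ ω, φ N (row 0 ω) ∂P
  set W : ℝ := ∫ ω, ψ (row 0 ω) ∂P
  have hbound : ∀ N n : ℕ, ∫ ω, D 0 n ω ∂P ≤ n * c + (n * e N + N * W) := by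
    intro N n
    have hI : ∀ k,
        Integrable (fun ω => φ N (row k ω) + if n ≤ k + N then ψ (row k ω) else 0) P := by
      intro k
      refine ((hφk N k).integrable_iff.2 (hφint0 N)).add ?_
      split_ifs
      exacts [(hψk k).integrable_iff.2 hψint0, integrable_zero _ _ _]
    calc ∫ ω, D 0 n ω ∂P
        ≤ ∫ ω, (n * c + ∑ k ∈ Finset.range n,
            (φ N (row k ω) + if n ≤ k + N then ψ (row k ω) else 0)) ∂P := by
          refine integral_mono_ae (hint n)
            ((integrable_const _).add (integrable_finsetSum _ fun k _ => hI k)) ?_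
          filter_upwards [hsub] with ω hω
          have h := le_mul_add_sum_of_blocks (D := fun i j => D i j ω) (w := fun k => ψ (row k ω))
            (c := c) N (fun i => h0 i ω) hω (fun k => hψ0 _) (fun i => by
              have h1 := le_abs_self (D i (i + 1) ω)
              have h2 := neg_abs_le c
              simp only [ψ, row]
              linarith) (fun k => good N (row k ω)) (fun k hk => hk) n n 0 (zero_add n)
          refine h.trans (add_le_add_right ?_ _)
          rw [Finset.range_eq_Ico]
          refine Finset.sum_le_sum fun k _ => ?_
          by_cases hg : good N (row k ω) <;> by_cases hk : k + N < n
          · simp [hg, hk, φ, not_le.2 hk]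
          · simp [hg, hk, φ, not_lt.1 hk]
          · simp [hg, φ, not_le.2 hk]
          · simp [hg, hk, φ, not_lt.1 hk, hψ0]
      _ = n * c + ∑ k ∈ Finset.range n, (e N + if n ≤ k + N then W else 0) := by
          rw [integral_add (integrable_const _) (integrable_finsetSum _ fun k _ => hI k),
            integral_finsetSum _ fun k _ => hI k]
          simp only [integral_const, probReal_univ, one_smul]
          congr 1
          refine Finset.sum_congr rfl fun k _ => ?_
          split_ifs
          · rw [integral_add ((hφk N k).integrable_iff.2 (hφint0 N))
              ((hψk k).integrable_iff.2 hψint0), (hφk N k).integral_eq, (hψk k).integral_eq]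
          · simp only [add_zero]
            exact (hφk N k).integral_eq
      _ ≤ n * c + (n * e N + N * W) := by
          have hW : 0 ≤ W := integral_nonneg fun _ => hψ0 _
          rw [Finset.sum_add_distrib, Finset.sum_const, Finset.card_range, nsmul_eq_mul,
            ← Finset.sum_filter, Finset.sum_const, nsmul_eq_mul]
          refine add_le_add_right (add_le_add_right (mul_le_mul_of_nonneg_right ?_ hW) _) _
          have hcard : (Finset.range n).filter (fun k => n ≤ k + N) ⊆ Finset.Ico (n - N) n := by
            intro k hk
            simp only [Finset.mem_filter, Finset.mem_range, Finset.mem_Ico] at hk ⊢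
            omega
          have := Finset.card_le_card hcard
          rw [Nat.card_Ico] at this
          exact_mod_cast this.trans (by omega)
  have he : Tendsto e atTop (𝓝 0) := by
    have : Tendsto e atTop (𝓝 (∫ _, (0 : ℝ) ∂P)) := by
      refine tendsto_integral_of_dominated_convergence (fun ω => ψ (row 0 ω))
        (fun N => (hφint0 N).aestronglyMeasurable) hψint0 (fun N => .of_forall fun ω => ?_) ?_
      · rw [Real.norm_eq_abs, abs_of_nonneg (hφ0 _ _)]; exact hφψ _ _
      · filter_upwards [hex] with ω hω
        obtain ⟨n, hn1, hn⟩ := hω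
        refine tendsto_const_nhds.congr' ?_
        filter_upwards [eventually_ge_atTop n] with N hN
        have : good N (row 0 ω) := ⟨n, hn1, hN, by simpa [row] using hn⟩
        simp [φ, this]
    simpa using this
  have hN : ∀ N, γ ≤ c + e N := by
    intro N
    by_contra! hlt
    obtain ⟨n, hn⟩ := exists_nat_gt ((N * W) / (γ - (c + e N)))
    rw [div_lt_iff₀ (by linarith)] at hn
    have h1 := (hγ n).trans (hbound N n)
    linarith
  have := ge_of_tendsto (tendsto_const_nhds.add he) (.of_forall hN)
  simpa using this

/-- Integrable variables with a common law grow slower than linearly. -/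
lemma ae_tendsto_div_zero_of_identDistrib {Z : ℕ → Ω → ℝ} (hnn : ∀ n ω, 0 ≤ Z n ω)
    (hint : Integrable (Z 0) P) (hid : ∀ n, ProbabilityTheory.IdentDistrib (Z n) (Z 0) P P) :
    ∀ᵐ ω ∂P, Tendsto (fun n : ℕ => Z n ω / n) atTop (𝓝 0) := by
  have key : ∀ m : ℕ, ∀ᵐ ω ∂P, ∀ᶠ n : ℕ in atTop, (m + 1 : ℝ) * Z n ω ≤ n := by
    intro m
    have hm : Measurable fun x : ℝ => (m + 1 : ℝ) * x := measurable_const_mul _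
    let _ : MeasureSpace Ω := ⟨P⟩
    have hsum : (∑' n : ℕ, P {ω | (m + 1 : ℝ) * Z n ω ∈ Set.Ioi (n : ℝ)}) ≠ ⊤ := by
      have h := ProbabilityTheory.tsum_prob_mem_Ioi_lt_top
        (X := fun ω => (m + 1 : ℝ) * Z 0 ω) (hint.const_mul _)
        (fun ω => mul_nonneg (by positivity) (hnn 0 ω))
      refine (lt_of_eq_of_lt (tsum_congr fun n => ?_) h).ne
      exact ((hid n).comp hm).measure_mem_eq measurableSet_Ioi
    filter_upwards [ae_eventually_notMem hsum] with ω hω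
    filter_upwards [hω] with n hn
    simpa using hn
  filter_upwards [ae_all_iff.2 key] with ω hω
  rw [Metric.tendsto_atTop]
  intro ε hε
  obtain ⟨m, hm⟩ := exists_nat_gt ε⁻¹
  obtain ⟨N, hN⟩ := eventually_atTop.1 (hω m)
  refine ⟨N + 1, fun n hn => ?_⟩
  have hn0 : (0 : ℝ) < n := by exact_mod_cast (by omega : 0 < n)
  rw [Real.dist_0_eq_abs, abs_of_nonneg (div_nonneg (hnn n ω) hn0.le), div_lt_iff₀ hn0]
  have h1 := hN n (by omega)
  have hm1 : (0 : ℝ) < m + 1 := by positivity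
  have h2 : ε⁻¹ < m + 1 := by linarith
  rw [inv_lt_iff_one_lt_mul₀ hε] at h2
  by_contra! h3
  have h4 : (m + 1 : ℝ) * (ε * n) ≤ n := (mul_le_mul_of_nonneg_left h3 hm1.le).trans h1
  nlinarith

end Subadditive

section TimeConstant

variable {d : ℕ} {Ω : Type*} [MeasurableSpace Ω] {P : Measure Ω} {g : Ω → MatrixField d}

/-! ### The time constant -/

/-- The standing assumptions on the random metric: ergodicity, almost sure regularity and the weak
moment condition. -/
structure IsErgodicMetric (g : Ω → MatrixField d) (P : Measure Ω) : Prop where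
  metric : IsRandomMetric g
  ergodic : IsErgodicField g P
  regular : ∀ᵐ ω ∂P, IsRegular (g ω)
  moment : ∀ v : Space d, Integrable (fun ω => matrixNorm (g ω 0) v) P

/-- The mean distance from the origin to `v`. -/
noncomputable def meanDist (g : Ω → MatrixField d) (P : Measure Ω) (v : Space d) : ℝ :=
  ∫ ω, riemDist (g ω) 0 v ∂P

/-- The linear growth rate of the mean distance in the direction `v`, as an infimum. -/
noncomputable def timeConst (g : Ω → MatrixField d) (P : Measure Ω) (v : Space d) : ℝ :=
  sInf ((fun n : ℕ => meanDist g P ((n : ℝ) • v) / n) '' Set.Ici 1)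

lemma meanDist_nonneg (g : Ω → MatrixField d) (P : Measure Ω) (v : Space d) :
    0 ≤ meanDist g P v := integral_nonneg fun _ => riemDist_nonneg _ _ _

lemma timeConst_nonneg (g : Ω → MatrixField d) (P : Measure Ω) (v : Space d) :
    0 ≤ timeConst g P v := by
  refine Real.sInf_nonneg ?_
  rintro _ ⟨n, -, rfl⟩
  exact div_nonneg (meanDist_nonneg _ _ _) (Nat.cast_nonneg n)

lemma bddBelow_meanDist_div (g : Ω → MatrixField d) (P : Measure Ω) (v : Space d) :
    BddBelow ((fun n : ℕ => meanDist g P ((n : ℝ) • v) / n) '' Set.Ici 1) := by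
  refine ⟨0, ?_⟩
  rintro _ ⟨n, -, rfl⟩
  exact div_nonneg (meanDist_nonneg _ _ _) (Nat.cast_nonneg n)

lemma mul_timeConst_le (g : Ω → MatrixField d) (P : Measure Ω) (v : Space d) (n : ℕ) :
    n * timeConst g P v ≤ meanDist g P ((n : ℝ) • v) := by
  rcases Nat.eq_zero_or_pos n with rfl | hn
  · simpa using meanDist_nonneg g P _
  have h : timeConst g P v ≤ meanDist g P ((n : ℝ) • v) / n :=
    csInf_le (bddBelow_meanDist_div g P v) ⟨n, hn, rfl⟩
  rwa [le_div_iff₀ (by exact_mod_cast hn), mul_comm] at h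

lemma meanDist_zero : meanDist g P 0 = 0 := by simp [meanDist, riemDist_self]

lemma exists_frequently_lt_congr {a b : ℕ → ℝ} (hab : Tendsto (fun n => a n - b n) atTop (𝓝 0))
    {c : ℝ} (ha : ∃ q : ℚ, c < q ∧ ∃ᶠ n in atTop, (q : ℝ) < a n) :
    ∃ q : ℚ, c < q ∧ ∃ᶠ n in atTop, (q : ℝ) < b n := by
  obtain ⟨q, hq, hf⟩ := ha
  obtain ⟨q', hq', hq'q⟩ := exists_rat_btwn hq
  refine ⟨q', hq', ?_⟩
  refine (hf.and_eventually (hab.eventually_lt_const (sub_pos.2 hq'q))).mono fun n hn => ?_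
  linarith [hn.1, hn.2]

namespace IsErgodicMetric

lemma identDistrib (h : IsErgodicMetric g P) (v : Space d) {ι : Type*} (x y : ι → Space d) :
    ProbabilityTheory.IdentDistrib (fun ω i => riemDist (g ω) (v + x i) (v + y i))
      (fun ω i => riemDist (g ω) (x i) (y i)) P P :=
  h.ergodic.identDistrib_riemDist h.metric h.regular v x y

lemma identDistrib_pair (h : IsErgodicMetric g P) (v x y : Space d) :
    ProbabilityTheory.IdentDistrib (fun ω => riemDist (g ω) (v + x) (v + y))
      (fun ω => riemDist (g ω) x y) P P :=
  (h.identDistrib v (fun _ : Unit => x) fun _ => y).comp (measurable_pi_apply ())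

lemma integrable (h : IsErgodicMetric g P) (x y : Space d) :
    Integrable (fun ω => riemDist (g ω) x y) P :=
  h.ergodic.integrable_riemDist h.metric h.regular h.moment x y

lemma integral_riemDist (h : IsErgodicMetric g P) (x y : Space d) :
    ∫ ω, riemDist (g ω) x y ∂P = meanDist g P (y - x) := by
  have := (h.identDistrib_pair x 0 (y - x)).integral_eq
  rwa [add_zero, add_sub_cancel] at this

lemma meanDist_add (h : IsErgodicMetric g P) (v w : Space d) :
    meanDist g P (v + w) ≤ meanDist g P v + meanDist g P w := by
  have h1 := h.integral_riemDist v (v + w)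
  rw [add_sub_cancel_left] at h1
  rw [← h1, meanDist, meanDist, ← integral_add (h.integrable _ _) (h.integrable _ _)]
  refine integral_mono_ae (h.integrable _ _) ((h.integrable _ _).add (h.integrable _ _)) ?_
  filter_upwards [h.regular] with ω hω using hω.riemDist_triangle _ _ _

lemma meanDist_neg (h : IsErgodicMetric g P) (v : Space d) :
    meanDist g P (-v) = meanDist g P v := by
  have h1 := h.integral_riemDist v 0
  rw [zero_sub] at h1
  rw [← h1, meanDist]
  simp only [riemDist_comm _ v 0]

lemma meanDist_smul_le (h : IsErgodicMetric g P) (t : ℝ) (v : Space d) :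
    meanDist g P (t • v) ≤ |t| * ∫ ω, matrixNorm (g ω 0) v ∂P := by
  have := h.ergodic.integral_riemDist_le h.metric h.regular h.moment 0 (t • v)
  simp only [sub_zero, matrixNorm_smul, integral_const_mul] at this
  exact this

lemma tendsto_meanDist_nat (h : IsErgodicMetric g P) (v : Space d) :
    Tendsto (fun n : ℕ => meanDist g P ((n : ℝ) • v) / n) atTop (𝓝 (timeConst g P v)) := by
  have hs : Subadditive fun n : ℕ => meanDist g P ((n : ℝ) • v) := by
    intro m n
    simp only [Nat.cast_add, add_smul]
    exact h.meanDist_add _ _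
  have := hs.tendsto_lim ⟨0, by
    rintro _ ⟨n, rfl⟩
    exact div_nonneg (meanDist_nonneg _ _ _) (Nat.cast_nonneg n)⟩
  rwa [Subadditive.lim] at this

lemma tendsto_meanDist (h : IsErgodicMetric g P) (v : Space d) :
    Tendsto (fun t : ℝ => meanDist g P (t • v) / t) atTop (𝓝 (timeConst g P v)) := by
  set N := ∫ ω, matrixNorm (g ω 0) v ∂P
  have hN : 0 ≤ N := integral_nonneg fun _ => matrixNorm_nonneg _ _
  have hdiff : ∀ t : ℝ, 0 ≤ t →
      |meanDist g P (t • v) - meanDist g P ((⌊t⌋₊ : ℝ) • v)| ≤ N := by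
    intro t ht
    have hfr : ∀ r : ℝ, |r| ≤ 1 → meanDist g P (r • v) ≤ N := fun r hr =>
      (h.meanDist_smul_le r v).trans (mul_le_of_le_one_left hN hr)
    have hf1 := Nat.floor_le ht
    have hf2 := Nat.lt_floor_add_one t
    have h1 := h.meanDist_add ((⌊t⌋₊ : ℝ) • v) ((t - ⌊t⌋₊) • v)
    have h2 := h.meanDist_add (t • v) ((⌊t⌋₊ - t) • v)
    rw [← add_smul, add_sub_cancel] at h1 h2
    have h3 := hfr (t - ⌊t⌋₊) (abs_le.2 ⟨by linarith, by linarith⟩)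
    have h4 := hfr (⌊t⌋₊ - t) (abs_le.2 ⟨by linarith, by linarith⟩)
    exact abs_le.2 ⟨by linarith, by linarith⟩
  have h1 : Tendsto (fun t : ℝ => (meanDist g P (t • v) - meanDist g P ((⌊t⌋₊ : ℝ) • v)) / t)
      atTop (𝓝 0) := by
    have hlim : Tendsto (fun t : ℝ => N / t) atTop (𝓝 0) := tendsto_const_nhds.div_atTop tendsto_id
    refine squeeze_zero_norm' ?_ hlim
    filter_upwards [eventually_gt_atTop 0] with t ht
    rw [norm_div, Real.norm_eq_abs, Real.norm_eq_abs, abs_of_pos ht]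
    exact div_le_div_of_nonneg_right (hdiff t ht.le) ht.le
  have h2 : Tendsto (fun t : ℝ => meanDist g P ((⌊t⌋₊ : ℝ) • v) / ⌊t⌋₊ * (⌊t⌋₊ / t)) atTop
      (𝓝 (timeConst g P v * 1)) :=
    ((h.tendsto_meanDist_nat v).comp tendsto_nat_floor_atTop).mul tendsto_nat_floor_div_atTop
  have h3 := h1.add h2
  rw [zero_add, mul_one] at h3
  refine h3.congr' ?_
  filter_upwards [eventually_ge_atTop 1] with t ht
  have hfl : (⌊t⌋₊ : ℝ) ≠ 0 := by
    have : 0 < ⌊t⌋₊ := Nat.floor_pos.2 ht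
    exact_mod_cast this.ne'
  have ht0 : t ≠ 0 := by linarith
  field_simp
  ring

lemma timeConst_add_le (h : IsErgodicMetric g P) (v w : Space d) :
    timeConst g P (v + w) ≤ timeConst g P v + timeConst g P w := by
  refine le_of_tendsto_of_tendsto (h.tendsto_meanDist_nat (v + w))
    ((h.tendsto_meanDist_nat v).add (h.tendsto_meanDist_nat w)) (.of_forall fun n => ?_)
  simp only [smul_add]
  rw [← add_div]
  exact div_le_div_of_nonneg_right (h.meanDist_add _ _) (Nat.cast_nonneg n)

lemma timeConst_neg (h : IsErgodicMetric g P) (v : Space d) :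
    timeConst g P (-v) = timeConst g P v := by
  simp only [timeConst, smul_neg, h.meanDist_neg]

lemma timeConst_smul (h : IsErgodicMetric g P) (a : ℝ) (v : Space d) :
    timeConst g P (a • v) = |a| * timeConst g P v := by
  have hpos : ∀ a : ℝ, 0 < a → timeConst g P (a • v) = a * timeConst g P v := by
    intro a ha
    have h1 := h.tendsto_meanDist (a • v)
    have h2 := ((h.tendsto_meanDist v).comp (tendsto_id.atTop_mul_const ha)).const_mul a
    refine tendsto_nhds_unique h1 (h2.congr fun t => ?_)
    simp only [Function.comp, id, smul_smul]
    field_simp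
  rcases lt_trichotomy a 0 with ha | rfl | ha
  · rw [← neg_neg (a • v), h.timeConst_neg, ← neg_smul, hpos _ (neg_pos.2 ha), abs_of_neg ha]
  · have h1 := h.tendsto_meanDist_nat 0
    simp only [smul_zero, meanDist_zero, zero_div] at h1
    rw [zero_smul, abs_zero, zero_mul]
    exact tendsto_nhds_unique h1 tendsto_const_nhds
  · rw [hpos a ha, abs_of_pos ha]

variable [IsProbabilityMeasure P]

lemma ae_tendsto_div_zero (h : IsErgodicMetric g P) (u w : Space d) :
    ∀ᵐ ω ∂P, Tendsto (fun n : ℕ => riemDist (g ω) ((n : ℝ) • u) ((n : ℝ) • u + w) / n)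
      atTop (𝓝 0) := by
  refine ae_tendsto_div_zero_of_identDistrib (fun _ _ => riemDist_nonneg _ _ _)
    (h.integrable _ _) fun n => ?_
  have h1 := h.identDistrib_pair ((n : ℝ) • u) 0 w
  simpa using h1

/-- The event that the upper limit of `s * T(0, nv) / n` exceeds `c` is invariant under
translations up to null sets, so it is almost surely false or almost surely true. -/
lemma zero_one_limsup (h : IsErgodicMetric g P) (s c : ℝ) (v : Space d) :
    (∀ᵐ ω ∂P, ¬∃ q : ℚ, c < q ∧
      ∃ᶠ n : ℕ in atTop, (q : ℝ) < s * (riemDist (g ω) 0 ((n : ℝ) • v) / n)) ∨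
    ∀ᵐ ω ∂P, ∃ q : ℚ, c < q ∧
      ∃ᶠ n : ℕ in atTop, (q : ℝ) < s * (riemDist (g ω) 0 ((n : ℝ) • v) / n) := by
  let A : (Space d → Space d → ℝ) → Space d → Prop := fun T w => ∃ q : ℚ, c < q ∧
    ∃ᶠ n : ℕ in atTop, (q : ℝ) < s * (T w (w + (n : ℝ) • v) / n)
  let S : Set (MatrixField d) := {M | A (limDist M) 0}
  have hS : MeasurableSet S := by
    have : S = ⋃ q ∈ {q : ℚ | c < q}, ⋂ N : ℕ, ⋃ n ∈ Set.Ici N,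
        {M : MatrixField d | (q : ℝ) < s * (limDist M 0 (0 + (n : ℝ) • v) / n)} := by
      ext M; simp [S, A, frequently_atTop]
    rw [this]
    refine MeasurableSet.biUnion (Set.to_countable _) fun q _ => MeasurableSet.iInter fun N =>
      MeasurableSet.biUnion (Set.to_countable _) fun n _ => ?_
    exact measurableSet_lt measurable_const (((measurable_limDist _ _).div_const _).const_mul _)
  have hgS : ∀ᵐ ω ∂P, (g ω ∈ S ↔ A (riemDist (g ω)) 0) := by
    filter_upwards [h.regular] with ω hω
    have : limDist (g ω) = riemDist (g ω) := by ext x y; exact hω.limDist_eq x y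
    simp only [S, Set.mem_ofPred_eq, this]
  have hinv : ∀ w : Space d, {ω | (fun x => g ω (w + x)) ∈ S} =ᵐ[P] {ω | g ω ∈ S} := by
    intro w
    filter_upwards [h.regular, hgS, h.ae_tendsto_div_zero v w] with ω hω hωS hlim
    have e1 : (fun x => g ω (w + x)) ∈ S ↔ A (riemDist (g ω)) w := by
      have : ∀ x y, limDist (fun z => g ω (w + z)) x y = riemDist (g ω) (w + x) (w + y) :=
        fun x y => by rw [(hω.translate w).limDist_eq, riemDist_translate]
      simp only [S, A, Set.mem_ofPred_eq, this, zero_add, add_zero]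
    refine eq_iff_iff.2 ?_
    change (fun x => g ω (w + x)) ∈ S ↔ g ω ∈ S
    rw [e1, hωS]
    have hd : Tendsto (fun n : ℕ => s * (riemDist (g ω) w (w + (n : ℝ) • v) / n)
        - s * (riemDist (g ω) 0 (0 + (n : ℝ) • v) / n)) atTop (𝓝 0) := by
      have h0 : Tendsto (fun n : ℕ => riemDist (g ω) 0 w / n) atTop (𝓝 0) :=
        tendsto_const_nhds.div_atTop tendsto_natCast_atTop_atTop
      have h1 := ((h0.add hlim).const_mul |s|)
      rw [add_zero, mul_zero] at h1
      refine squeeze_zero_norm (fun n => ?_) h1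
      rw [← mul_sub, norm_mul, Real.norm_eq_abs, Real.norm_eq_abs]
      refine mul_le_mul_of_nonneg_left ?_ (abs_nonneg s)
      rw [← sub_div, ← add_div, abs_div, abs_of_nonneg (Nat.cast_nonneg n : (0 : ℝ) ≤ n)]
      refine div_le_div_of_nonneg_right ?_ (Nat.cast_nonneg n)
      rw [zero_add, add_comm w]
      have t1 := hω.riemDist_triangle w 0 ((n : ℝ) • v + w)
      have t2 := hω.riemDist_triangle 0 ((n : ℝ) • v) ((n : ℝ) • v + w)
      have t3 := hω.riemDist_triangle 0 w ((n : ℝ) • v)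
      have t4 := hω.riemDist_triangle w ((n : ℝ) • v + w) ((n : ℝ) • v)
      rw [riemDist_comm _ w 0] at t1
      rw [riemDist_comm _ ((n : ℝ) • v + w) ((n : ℝ) • v)] at t4
      exact abs_le.2 ⟨by linarith, by linarith⟩
    refine ⟨exists_frequently_lt_congr hd, exists_frequently_lt_congr ?_⟩
    simpa using hd.neg
  have hA0 : ∀ ω, A (riemDist (g ω)) 0 ↔ ∃ q : ℚ, c < q ∧
      ∃ᶠ n : ℕ in atTop, (q : ℝ) < s * (riemDist (g ω) 0 ((n : ℝ) • v) / n) := by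
    intro ω; simp only [A, zero_add]
  have hmeas : MeasurableSet {ω | g ω ∈ S} := h.metric.measurable_field hS
  rcases h.ergodic.zero_or_one S hS hinv with h0 | h1
  · left
    have : ∀ᵐ ω ∂P, g ω ∉ S := by rw [ae_iff]; simpa using h0
    filter_upwards [this, hgS] with ω h1 h2
    rwa [← hA0, ← h2]
  · right
    have : ∀ᵐ ω ∂P, g ω ∈ S := (prob_compl_eq_zero_iff hmeas).2 h1
    filter_upwards [this, hgS] with ω h1 h2
    rwa [← hA0, ← h2]

/-- A lower limit of `T(0, nv) / n` below `-c` provides almost surely a block of slope at most `-c`,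
and then the time constant is at most `-c`. -/
lemma ae_le_liminf (h : IsErgodicMetric g P) {v : Space d} {c : ℝ} (hc : -timeConst g P v < c) :
    ∀ᵐ ω ∂P, ¬∃ q : ℚ, c < q ∧
      ∃ᶠ n : ℕ in atTop, (q : ℝ) < (-1) * (riemDist (g ω) 0 ((n : ℝ) • v) / n) := by
  refine (h.zero_one_limsup (-1) c v).resolve_right fun hA => ?_
  have key := le_of_ae_exists_block_le (P := P) (γ := timeConst g P v) (c := -c)
    (D := fun i j ω => riemDist (g ω) ((i : ℝ) • v) ((j : ℝ) • v))
    (fun n => h.integrable _ _) (fun i ω => riemDist_self _ _) ?_ ?_ ?_ ?_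
  · linarith
  · filter_upwards [h.regular] with ω hω i j k _ _ using hω.riemDist_triangle _ _ _
  · intro k
    have := h.identDistrib ((k : ℝ) • v) (fun _ : ℕ => 0) (fun n : ℕ => (n : ℝ) • v)
    simpa [add_smul] using this
  · intro n
    simpa [meanDist] using mul_timeConst_le g P v n
  · filter_upwards [hA] with ω hω
    obtain ⟨q, hq, hf⟩ := hω
    obtain ⟨n, hn, hn1⟩ := (hf.and_eventually (eventually_ge_atTop 1)).exists
    refine ⟨n, hn1, ?_⟩
    have hn0 : (0 : ℝ) < n := by exact_mod_cast hn1
    have h1 : riemDist (g ω) 0 ((n : ℝ) • v) / n < -c := by linarith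
    rw [div_lt_iff₀ hn0] at h1
    simp only [Nat.cast_zero, zero_smul]
    linarith

/-- The sums of the distances between consecutive multiples of `mv` dominate `T(0, nv)` up to a
sublinear remainder, and for suitable `m` their mean slope is below `c`. If the upper limit of
`T(0, nv) / n` exceeded `c` almost surely, so would the slope of some block of these sums, and hence
their mean slope. -/
lemma ae_limsup_le (h : IsErgodicMetric g P) {v : Space d} {c : ℝ} (hc : timeConst g P v < c) :
    ∀ᵐ ω ∂P, ¬∃ q : ℚ, c < q ∧
      ∃ᶠ n : ℕ in atTop, (q : ℝ) < 1 * (riemDist (g ω) 0 ((n : ℝ) • v) / n) := by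
  refine (h.zero_one_limsup 1 c v).resolve_right fun hA => ?_
  obtain ⟨_, ⟨m, hm, rfl⟩, hmc⟩ := exists_lt_of_csInf_lt (Set.Nonempty.image _ ⟨1, le_rfl⟩) hc
  have hm0 : (0 : ℝ) < m := by exact_mod_cast (Set.mem_Ici.1 hm : 1 ≤ m)
  simp only [div_lt_iff₀ hm0] at hmc
  set u : Space d := (m : ℝ) • v with hu
  have hstep : ∀ (l : ℕ), ∫ ω, riemDist (g ω) ((l : ℝ) • u) (((l + 1 : ℕ) : ℝ) • u) ∂P
      = meanDist g P u := by
    intro l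
    rw [h.integral_riemDist, ← sub_smul]
    simp
  have hsum : ∀ ω, IsRegular (g ω) → ∀ n : ℕ, riemDist (g ω) 0 ((n : ℝ) • u)
      ≤ ∑ l ∈ Finset.Ico 0 n, riemDist (g ω) ((l : ℝ) • u) (((l + 1 : ℕ) : ℝ) • u) := by
    intro ω hω n
    induction n with
    | zero => simp [riemDist_self]
    | succ n ih =>
      rw [Finset.sum_Ico_succ_top (Nat.zero_le n)]
      exact (hω.riemDist_triangle _ ((n : ℝ) • u) _).trans (by linarith)
  have key := le_of_ae_exists_block_le (P := P) (γ := -meanDist g P u) (c := -(c * m))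
    (D := fun i j ω => -∑ l ∈ Finset.Ico i j,
      riemDist (g ω) ((l : ℝ) • u) (((l + 1 : ℕ) : ℝ) • u))
    (fun n => (integrable_finsetSum _ fun l _ => h.integrable _ _).neg)
    (fun i ω => by simp) ?_ ?_ ?_ ?_
  · linarith
  · refine .of_forall fun ω i j k hij hjk => ?_
    rw [← Finset.sum_Ico_consecutive _ hij hjk, neg_add]
  · intro k
    have h1 := h.identDistrib ((k : ℝ) • u) (fun l : ℕ => (l : ℝ) • u)
      (fun l : ℕ => ((l + 1 : ℕ) : ℝ) • u)
    have hΦ : Measurable fun (x : ℕ → ℝ) (n : ℕ) => -∑ l ∈ Finset.range n, x l :=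
      measurable_pi_iff.2 fun n => (Finset.measurable_fun_sum _ fun l _ =>
        measurable_pi_apply l).neg
    have h2 := h1.comp hΦ
    simp only [Function.comp_def, ← add_smul] at h2
    simp only [Finset.sum_Ico_eq_sum_range, Nat.add_sub_cancel_left, Nat.sub_zero, zero_add]
    convert h2 using 9
    · push_cast; ring
    · push_cast; ring
  · intro n
    rw [integral_neg, integral_finsetSum _ fun l _ => h.integrable _ _]
    simp only [hstep, Finset.sum_const, Nat.card_Ico, nsmul_eq_mul, Nat.sub_zero]
    linarith
  · have hrem : ∀ᵐ ω ∂P, ∀ r : ℕ, Tendsto (fun n : ℕ =>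
        riemDist (g ω) ((n : ℝ) • u) ((n : ℝ) • u + (r : ℝ) • v) / n) atTop (𝓝 0) :=
      ae_all_iff.2 fun r => h.ae_tendsto_div_zero u ((r : ℝ) • v)
    filter_upwards [hA, hrem, h.regular] with ω ⟨q, hq, hf⟩ hr hω
    have hev : ∀ᶠ n : ℕ in atTop, ∀ r ∈ Finset.range m,
        riemDist (g ω) ((n : ℝ) • u) ((n : ℝ) • u + (r : ℝ) • v) / n < q - c :=
      (Finset.eventually_all _).2 fun r _ => (hr r).eventually_lt_const (sub_pos.2 hq)
    have hdiv : Tendsto (fun N : ℕ => N / m) atTop atTop := Nat.tendsto_div_const_atTop (by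
      have := Set.mem_Ici.1 hm; omega)
    obtain ⟨N, hN, hN1, hN2⟩ := (hf.and_eventually
      ((hdiv.eventually hev).and (hdiv.eventually (eventually_ge_atTop 1)))).exists
    refine ⟨N / m, hN2, ?_⟩
    set n := N / m with hn
    have hn0 : (0 : ℝ) < n := by exact_mod_cast hN2
    have hN0 : (0 : ℝ) < N := by
      have : 0 < N := Nat.pos_of_ne_zero fun h0 => by simp [hn, h0] at hN2
      exact_mod_cast this
    have h1 := hN1 (N % m) (Finset.mem_range.2 (Nat.mod_lt _ (Set.mem_Ici.1 hm)))
    have hNeq : (n : ℝ) * m + (N % m : ℕ) = N := by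
      exact_mod_cast (by rw [hn, mul_comm]; exact Nat.div_add_mod N m)
    have hNv : (n : ℝ) • u + ((N % m : ℕ) : ℝ) • v = (N : ℝ) • v := by
      rw [hu, smul_smul, ← add_smul, hNeq]
    rw [hNv, div_lt_iff₀ hn0] at h1
    rw [one_mul, lt_div_iff₀ hN0] at hN
    have h2 := hω.riemDist_triangle 0 ((n : ℝ) • u) ((N : ℝ) • v)
    have h3 := hsum ω hω n
    have hc0 : 0 < c := (timeConst_nonneg g P v).trans_lt hc
    have hmod : (0 : ℝ) ≤ (N % m : ℕ) := Nat.cast_nonneg _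
    have hm1 : (1 : ℝ) ≤ m := by exact_mod_cast Set.mem_Ici.1 hm
    have h4 : (q : ℝ) * (n * m) ≤ q * N :=
      mul_le_mul_of_nonneg_left (by linarith) (by linarith)
    have h5 : (q - c) * n ≤ (q - c) * (n * m) :=
      mul_le_mul_of_nonneg_left (by nlinarith) (by linarith)
    simp only [mul_neg]
    nlinarith

lemma ae_tendsto (h : IsErgodicMetric g P) (v : Space d) : ∀ᵐ ω ∂P,
    Tendsto (fun n : ℕ => riemDist (g ω) 0 ((n : ℝ) • v) / n) atTop (𝓝 (timeConst g P v)) := by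
  have hup : ∀ᵐ ω ∂P, ∀ c : ℚ, timeConst g P v < c → ¬∃ q : ℚ, (c : ℝ) < q ∧
      ∃ᶠ n : ℕ in atTop, (q : ℝ) < 1 * (riemDist (g ω) 0 ((n : ℝ) • v) / n) :=
    ae_all_iff.2 fun c => by
      by_cases hc : timeConst g P v < c
      · filter_upwards [h.ae_limsup_le hc] with ω hω _ using hω
      · exact .of_forall fun ω h' => absurd h' hc
  have hlow : ∀ᵐ ω ∂P, ∀ c : ℚ, -timeConst g P v < c → ¬∃ q : ℚ, (c : ℝ) < q ∧
      ∃ᶠ n : ℕ in atTop, (q : ℝ) < (-1) * (riemDist (g ω) 0 ((n : ℝ) • v) / n) :=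
    ae_all_iff.2 fun c => by
      by_cases hc : -timeConst g P v < c
      · filter_upwards [h.ae_le_liminf hc] with ω hω _ using hω
      · exact .of_forall fun ω h' => absurd h' hc
  filter_upwards [hup, hlow] with ω h1 h2
  refine tendsto_order.2 ⟨fun a ha => ?_, fun a ha => ?_⟩
  · obtain ⟨q, hq1, hq2⟩ := exists_rat_btwn (neg_lt_neg ha)
    obtain ⟨c, hc1, hc2⟩ := exists_rat_btwn hq1
    by_contra hcon
    refine h2 c hc1 ⟨q, hc2, (not_eventually.1 hcon).mono fun n hn => ?_⟩
    rw [not_lt] at hn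
    linarith
  · obtain ⟨q, hq1, hq2⟩ := exists_rat_btwn ha
    obtain ⟨c, hc1, hc2⟩ := exists_rat_btwn hq1
    by_contra hcon
    refine h1 c hc1 ⟨q, hc2, (not_eventually.1 hcon).mono fun n hn => ?_⟩
    rw [not_lt] at hn
    linarith

end IsErgodicMetric

/-- Scheffé's lemma for a constant limit. -/
lemma tendsto_integral_abs_sub_of_tendsto_integral [IsProbabilityMeasure P] {X : ℕ → Ω → ℝ}
    {L : ℝ} (hX0 : ∀ n ω, 0 ≤ X n ω) (hX : ∀ n, Integrable (X n) P) (hL : 0 ≤ L)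
    (hae : ∀ᵐ ω ∂P, Tendsto (fun n => X n ω) atTop (𝓝 L))
    (hmean : Tendsto (fun n => ∫ ω, X n ω ∂P) atTop (𝓝 L)) :
    Tendsto (fun n => ∫ ω, |X n ω - L| ∂P) atTop (𝓝 0) := by
  have hI : ∀ n, Integrable (fun ω => max (L - X n ω) 0) P := fun n =>
    ((integrable_const L).sub (hX n)).pos_part
  have h1 : Tendsto (fun n => ∫ ω, max (L - X n ω) 0 ∂P) atTop (𝓝 (∫ _, (0 : ℝ) ∂P)) := by
    refine tendsto_integral_of_dominated_convergence (fun _ => L)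
      (fun n => (hI n).aestronglyMeasurable) (integrable_const L)
      (fun n => .of_forall fun ω => ?_) ?_
    · rw [Real.norm_eq_abs, abs_of_nonneg (le_max_right _ _)]
      exact max_le (by linarith [hX0 n ω]) hL
    · filter_upwards [hae] with ω hω
      have := (tendsto_const_nhds (x := L)).sub hω |>.max (tendsto_const_nhds (x := (0 : ℝ)))
      simpa using this
  have h2 : ∀ n, ∫ ω, |X n ω - L| ∂P = (∫ ω, X n ω ∂P) - L + 2 * ∫ ω, max (L - X n ω) 0 ∂P := by
    intro n
    rw [← integral_const_mul]
    have e : ∀ ω, |X n ω - L| = X n ω - L + 2 * max (L - X n ω) 0 := by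
      intro ω
      rcases le_total L (X n ω) with h | h
      · rw [abs_of_nonneg (by linarith), max_eq_right (by linarith)]; ring
      · rw [abs_of_nonpos (by linarith), max_eq_left (by linarith)]; ring
    simp only [e]
    have hs : Integrable (fun ω => X n ω - L) P := (hX n).sub (integrable_const L)
    rw [integral_add hs ((hI n).const_mul 2), integral_sub (hX n) (integrable_const L)]
    simp
  simp only [h2]
  have h3 := (hmean.sub_const L).add (h1.const_mul 2)
  simpa using h3

lemma IsErgodicMetric.isTimeConstant [IsProbabilityMeasure P] (h : IsErgodicMetric g P) :
    IsTimeConstant g P (timeConst g P) where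
  tendsto_ae := h.ae_tendsto
  integrable := h.integrable 0
  tendsto_L1 v := by
    refine tendsto_integral_abs_sub_of_tendsto_integral
      (fun n ω => div_nonneg (riemDist_nonneg _ _ _) (Nat.cast_nonneg n))
      (fun n => (h.integrable _ _).div_const _) (timeConst_nonneg g P v) (h.ae_tendsto v) ?_
    simp only [integral_div]
    exact h.tendsto_meanDist_nat v

end TimeConstant

section Crossings

variable {d : ℕ} {M : MatrixField d} {Ω : Type*} [MeasurableSpace Ω] {P : Measure Ω}
  {g : Ω → MatrixField d}

/-! ### Fast crossings of annuli -/

/-- The annulus between the spheres of radii `r` and `R` about `y` is crossed outwards in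
`M`-distance less than `t`. -/
def Crosses (M : MatrixField d) (y : Space d) (r R t : ℝ) : Prop :=
  ∃ p ∈ Metric.ball y r, ∃ q ∉ Metric.closedBall y R, riemDist M p q < t

/-- The version of `Crosses` that reads a pseudometric at countably many points of the ball of
radius `2 * R` only. -/
def crossingSet (y : Space d) (r R t : ℝ) : Set (PseudoMetric (Space d) ℝ) :=
  {D | ∃ p ∈ Metric.ball y r ∩ densePoints d,
    ∃ q ∈ (Metric.ball y (2 * R) \ Metric.closedBall y R) ∩ densePoints d, D p q < t}

/-- The pseudometric induced by a regular metric. -/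
noncomputable def IsRegular.pseudoMetric (hM : IsRegular M) : PseudoMetric (Space d) ℝ where
  toFun := riemDist M
  refl' := riemDist_self M
  symm' := riemDist_comm M
  triangle' := hM.riemDist_triangle

lemma crosses_translate (M : MatrixField d) (v y : Space d) (r R t : ℝ) :
    Crosses (fun z => M (v + z)) y r R t ↔ Crosses M (v + y) r R t := by
  simp only [Crosses, riemDist_translate]
  constructor
  · rintro ⟨p, hp, q, hq, h⟩
    exact ⟨v + p, by simpa using hp, v + q, by simpa using hq, h⟩
  · rintro ⟨p, hp, q, hq, h⟩
    refine ⟨-v + p, ?_, -v + q, ?_, by simpa using h⟩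
    · rw [Metric.mem_ball, ← dist_add_left v] at *; simpa using hp
    · rw [Metric.mem_closedBall, ← dist_add_left v] at *; simpa using hq

/-- A fast crossing can be realised by a polygon in the ball of radius `2 * R`, with vertices in a
countable dense set. -/
lemma IsRegular.crosses_iff_polyDist (hM : IsRegular M) (y : Space d) {r R : ℝ} (hr : 0 < r)
    (hrR : r ≤ R) (t : ℝ) : Crosses M y r R t ↔
      ∃ q ∈ (Metric.ball y (2 * R) \ Metric.closedBall y R) ∩ densePoints d,
        polyDist M (Metric.ball y r ∩ densePoints d) (Metric.ball y (2 * R)) q < t := by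
  constructor
  · rintro ⟨p, hp, q, hq, h⟩
    by_contra! hcon
    refine absurd h (not_lt.2 (hM.le_riemDist_of_polyDist Metric.isOpen_ball
      ((Metric.ball_subset_ball hrR).trans Metric.ball_subset_closedBall) Metric.isClosed_closedBall
      (Metric.closedBall_subset_ball (by linarith)) Metric.isOpen_ball
      (fun z hz hzQ => hcon z ⟨hz, hzQ⟩) hp hq))
  · rintro ⟨q, hq, h⟩
    obtain ⟨z, hz, hzO⟩ := (dense_densePoints d).exists_mem_open Metric.isOpen_ball
      ⟨y, Metric.mem_ball_self hr⟩
    obtain ⟨p, hp, l, hl⟩ :=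
      exists_polyLength_lt (C := Metric.ball y r ∩ densePoints d) ⟨z, hzO, hz⟩ h
    exact ⟨p, hp.1, q, hq.1.2, (hM.riemDist_le_polyLength _ _ _).trans_lt hl⟩

lemma IsRegular.crosses_iff_mem_crossingSet (hM : IsRegular M) (y : Space d) {r R : ℝ}
    (hr : 0 < r) (hrR : r ≤ R) (t : ℝ) :
    Crosses M y r R t ↔ hM.pseudoMetric ∈ crossingSet y r R t := by
  constructor
  · intro h
    obtain ⟨q, hq, h⟩ := (hM.crosses_iff_polyDist y hr hrR t).1 h
    obtain ⟨z, hz, hzO⟩ := (dense_densePoints d).exists_mem_open Metric.isOpen_ball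
      ⟨y, Metric.mem_ball_self hr⟩
    obtain ⟨p, hp, l, hl⟩ :=
      exists_polyLength_lt (C := Metric.ball y r ∩ densePoints d) ⟨z, hzO, hz⟩ h
    exact ⟨p, hp, q, hq, (hM.riemDist_le_polyLength _ _ _).trans_lt hl⟩
  · rintro ⟨p, hp, q, hq, h⟩
    exact ⟨p, hp.1, q, hq.1.2, h⟩

lemma IsRegular.setOf_mem_crossingSet (hM : IsRegular M) {y : Space d} {r R : ℝ} (hr : 0 < r)
    (hrR : r ≤ R) (t : ℝ) :
    (∃ D ∈ crossingSet y r R t, ⇑D = riemDist M) ↔ Crosses M y r R t := by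
  rw [hM.crosses_iff_mem_crossingSet y hr hrR]
  constructor
  · rintro ⟨D, hD, h⟩
    have : D = hM.pseudoMetric := DFunLike.coe_injective h
    rwa [← this]
  · exact fun h => ⟨hM.pseudoMetric, h, rfl⟩

lemma distEvent_crossingSet (hreg : ∀ᵐ ω ∂P, IsRegular (g ω)) (y : Space d) {r R : ℝ} (hr : 0 < r)
    (hrR : r ≤ R) (t : ℝ) :
    distEvent g (crossingSet y r R t) =ᵐ[P] {ω | Crosses (g ω) y r R t} := by
  filter_upwards [hreg] with ω hω
  exact eq_iff_iff.2 (hω.setOf_mem_crossingSet hr hrR t)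

/-- The measurable version of `Crosses`. -/
def limCrosses (y : Space d) (r R t : ℝ) (M : MatrixField d) : Prop :=
  ∃ q ∈ (Metric.ball y (2 * R) \ Metric.closedBall y R) ∩ densePoints d,
    polyLimDist M (Metric.ball y r ∩ densePoints d) (Metric.ball y (2 * R)) q < t

lemma measurableSet_limCrosses {Ω : Type*} {m : MeasurableSpace Ω} {g : Ω → MatrixField d}
    {y : Space d} {r R : ℝ} (hrR : r ≤ 2 * R) (t : ℝ)
    (hg : ∀ x ∈ Metric.ball y (2 * R), Measurable fun ω => g ω x) :
    MeasurableSet {ω | limCrosses y r R t (g ω)} := by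
  have : {ω | limCrosses y r R t (g ω)}
      = ⋃ q ∈ (Metric.ball y (2 * R) \ Metric.closedBall y R) ∩ densePoints d,
        {ω | polyLimDist (g ω) (Metric.ball y r ∩ densePoints d) (Metric.ball y (2 * R)) q
          < t} := by
    ext ω; simp only [limCrosses, Set.mem_iUnion, Set.mem_ofPred_eq, exists_prop]
  rw [this]
  refine MeasurableSet.biUnion ((countable_densePoints d).mono Set.inter_subset_right)
    fun q hq => measurableSet_lt ?_ measurable_const
  exact measurable_polyLimDist (convex_ball _ _) hg
    ((countable_densePoints d).mono Set.inter_subset_right)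
    (Set.inter_subset_left.trans (Metric.ball_subset_ball hrR)) subset_rfl hq.1.1

lemma IsRegular.limCrosses_iff (hM : IsRegular M) (y : Space d) {r R : ℝ} (hr : 0 < r)
    (hrR : r ≤ R) (t : ℝ) : limCrosses y r R t M ↔ Crosses M y r R t := by
  rw [hM.crosses_iff_polyDist y hr hrR]
  simp only [limCrosses, hM.polyLimDist_eq]

lemma isDecreasingEventOver_crossingSet (hreg : ∀ᵐ ω ∂P, IsRegular (g ω)) (y : Space d) {r R : ℝ}
    (hr : 0 < r) (hrR : r ≤ R) (t : ℝ) :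
    IsDecreasingEventOver g P (Metric.ball y (2 * R)) (crossingSet y r R t) where
  decreasing := by
    rintro D D' hle ⟨p, hp, q, hq, h⟩
    exact ⟨p, hp, q, hq, (hle p q).trans_lt h⟩
  measurable := by
    have : crossingSet y r R t = ⋃ p ∈ Metric.ball y r ∩ densePoints d,
        ⋃ q ∈ (Metric.ball y (2 * R) \ Metric.closedBall y R) ∩ densePoints d,
        {D : PseudoMetric (Space d) ℝ | D p q < t} := by
      ext D; simp only [crossingSet, Set.mem_iUnion, Set.mem_ofPred_eq, exists_prop]
    rw [this]
    refine MeasurableSet.biUnion ((countable_densePoints d).mono Set.inter_subset_right)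
      fun p hp => MeasurableSet.biUnion
        ((countable_densePoints d).mono Set.inter_subset_right) fun q hq => ?_
    have hp' : p ∈ Metric.ball y (2 * R) := Metric.ball_subset_ball (by linarith) hp.1
    have hle : MeasurableSpace.comap (fun D : PseudoMetric (Space d) ℝ => D p q) inferInstance
        ≤ distSigma (Metric.ball y (2 * R)) :=
      le_iSup₂_of_le p hp' (le_iSup₂_of_le q hq.1.1 le_rfl)
    exact hle _ ⟨Set.Iio t, measurableSet_Iio, rfl⟩
  localField := by
    refine ⟨{ω | limCrosses y r R t (g ω)}, ?_, ?_⟩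
    · refine @measurableSet_limCrosses d Ω (fieldSigma g (Metric.ball y (2 * R))) g y r R
        (by linarith) t fun x hx => ?_
      have hle : MeasurableSpace.comap (fun ω => g ω x) inferInstance
          ≤ fieldSigma g (Metric.ball y (2 * R)) := le_iSup₂_of_le x hx le_rfl
      exact (comap_measurable _).mono hle le_rfl
    · filter_upwards [distEvent_crossingSet hreg y hr hrR t, hreg] with ω h1 h2
      refine h1.trans (eq_iff_iff.2 (h2.limCrosses_iff y hr hrR t).symm)

/-! ### Quasi-independence of fast crossings -/

lemma abs_le_indMinus [IsProbabilityMeasure P] {Q S : ℝ} {A B : Set (Space d)}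
    {EA EB : Set (PseudoMetric (Space d) ℝ)} (hA : Metric.ediam A ≤ ENNReal.ofReal S)
    (hB : Metric.ediam B ≤ ENNReal.ofReal S) (hAB : ENNReal.ofReal Q < setDist A B)
    (hEA : IsDecreasingEventOver g P A EA) (hEB : IsDecreasingEventOver g P B EB) :
    |P.real (distEvent g EA ∩ distEvent g EB)
      - P.real (distEvent g EA) * P.real (distEvent g EB)| ≤ indMinus g P Q S := by
  refine le_csSup ⟨1, ?_⟩ ⟨A, B, EA, EB, hA, hB, hAB, hEA, hEB, rfl⟩
  rintro _ ⟨A, B, EA, EB, -, -, -, -, -, rfl⟩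
  have h1 : P.real (distEvent g EA ∩ distEvent g EB) ∈ Set.Icc (0 : ℝ) 1 :=
    ⟨measureReal_nonneg, measureReal_le_one⟩
  have h2 : P.real (distEvent g EA) * P.real (distEvent g EB) ∈ Set.Icc (0 : ℝ) 1 :=
    ⟨mul_nonneg measureReal_nonneg measureReal_nonneg,
      mul_le_one₀ measureReal_le_one measureReal_nonneg measureReal_le_one⟩
  exact abs_le.2 ⟨by linarith [h1.1, h2.2], by linarith [h1.2, h2.1]⟩

/-- For a field of finite range the events in the definition of `indMinus` are independent. -/
lemma HasFiniteRange.isExpQuasiIndep (h : HasFiniteRange g P) : IsExpQuasiIndep g P := by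
  obtain ⟨Q₀, hQ₀, hind⟩ := h
  refine ⟨1, one_pos, fun α _ => ⟨Q₀, hQ₀, fun Q hQ => ?_⟩⟩
  refine le_trans (Real.sSup_le ?_ le_rfl) (Real.exp_pos _).le
  rintro _ ⟨A, B, EA, EB, -, -, hAB, hEA, hEB, rfl⟩
  obtain ⟨FA, hFA, hA⟩ := hEA.localField
  obtain ⟨FB, hFB, hB⟩ := hEB.localField
  have h1 := (ProbabilityTheory.Indep_iff _ _ _).1
    (hind A B ((ENNReal.ofReal_le_ofReal hQ).trans hAB.le)) FA FB hFA hFB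
  rw [measureReal_congr (hA.inter hB), measureReal_congr hA, measureReal_congr hB]
  simp only [Measure.real, h1, ENNReal.toReal_mul, sub_self, abs_zero, le_refl]

lemma ofReal_lt_setDist_ball {y₁ y₂ : Space d} {R : ℝ} (hR : 0 < R) (h : 6 * R ≤ dist y₁ y₂) :
    ENNReal.ofReal R < setDist (Metric.ball y₁ (2 * R)) (Metric.ball y₂ (2 * R)) := by
  refine lt_of_lt_of_le ((ENNReal.ofReal_lt_ofReal_iff (by linarith)).2
    (by linarith : R < 2 * R)) ?_
  refine le_iInf₂ fun a ha => le_iInf₂ fun b hb => ?_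
  rw [edist_dist]
  refine ENNReal.ofReal_le_ofReal ?_
  rw [Metric.mem_ball] at ha hb
  have h1 := dist_triangle4 y₁ a b y₂
  rw [dist_comm y₁ a] at h1
  linarith

/-- The probability of a fast crossing; by stationarity the centre does not matter. -/
noncomputable def crossProb (g : Ω → MatrixField d) (P : Measure Ω) (r R t : ℝ) : ℝ :=
  P.real {ω | Crosses (g ω) 0 r R t}

namespace IsErgodicMetric

lemma ae_limCrosses_iff (h : IsErgodicMetric g P) (y : Space d) {r R : ℝ} (hr : 0 < r)
    (hrR : r ≤ R) (t : ℝ) :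
    {ω | limCrosses y r R t (g ω)} =ᵐ[P] {ω | Crosses (g ω) y r R t} := by
  filter_upwards [h.regular] with ω hω
  exact eq_iff_iff.2 (hω.limCrosses_iff y hr hrR t)

lemma nullMeasurableSet_crosses (h : IsErgodicMetric g P) (y : Space d) {r R : ℝ} (hr : 0 < r)
    (hrR : r ≤ R) (t : ℝ) : NullMeasurableSet {ω | Crosses (g ω) y r R t} P :=
  (measurableSet_limCrosses (by linarith) t
    fun x _ => h.metric.measurable x).nullMeasurableSet.congr (h.ae_limCrosses_iff y hr hrR t)

lemma measureReal_crosses (h : IsErgodicMetric g P) (y : Space d) {r R : ℝ} (hr : 0 < r)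
    (hrR : r ≤ R) (t : ℝ) : P.real {ω | Crosses (g ω) y r R t} = crossProb g P r R t := by
  have hS : MeasurableSet {M : MatrixField d | limCrosses 0 r R t M} :=
    measurableSet_limCrosses (g := fun M : MatrixField d => M) (by linarith) t
      fun x _ => measurable_pi_apply x
  have h1 := (h.ergodic.identDistrib h.metric y).measure_mem_eq hS
  have h2 : {ω | (fun x => g ω (y + x)) ∈ {M : MatrixField d | limCrosses 0 r R t M}}
      =ᵐ[P] {ω | Crosses (g ω) y r R t} := by
    filter_upwards [h.regular] with ω hω
    refine eq_iff_iff.2 (((hω.translate y).limCrosses_iff 0 hr hrR t).trans ?_)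
    rw [crosses_translate, add_zero]
    rfl
  have h3 := h.ae_limCrosses_iff 0 hr hrR t
  rw [crossProb, ← measureReal_congr h2, ← measureReal_congr h3]
  exact congrArg ENNReal.toReal h1

/-- At a fixed scale, fast crossings become unlikely as the time tends to zero. -/
lemma exists_crossProb_le [IsProbabilityMeasure P] (h : IsErgodicMetric g P) {r R : ℝ}
    (hr : 0 < r) (hrR : r < R) {η : ℝ} (hη : 0 < η) : ∃ t > 0, crossProb g P r R t ≤ η := by
  let s : ℕ → Set Ω := fun n => {ω | Crosses (g ω) 0 r R (1 / ((n : ℝ) + 1))}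
  have hanti : Antitone s := by
    rintro m n hmn ω ⟨p, hp, q, hq, hlt⟩
    exact ⟨p, hp, q, hq, hlt.trans_le (Nat.one_div_le_one_div hmn)⟩
  have hlim := tendsto_measure_iInter_atTop (μ := P) (s := s)
    (fun n => h.nullMeasurableSet_crosses 0 hr hrR.le (1 / ((n : ℝ) + 1))) hanti
    ⟨0, measure_ne_top _ _⟩
  have hzero : P (⋂ n, s n) = 0 := by
    refine measure_mono_null (t := {ω | ¬IsRegular (g ω)}) (fun ω hω hreg => ?_) h.regular
    obtain ⟨c, hc, hcl⟩ := hreg.exists_pos_le_riemDist 0 hrR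
    obtain ⟨n, hn⟩ := exists_nat_one_div_lt hc
    obtain ⟨p, hp, q, hq, hlt⟩ := Set.mem_iInter.1 hω n
    linarith [hcl p hp q hq]
  rw [hzero] at hlim
  obtain ⟨n, hn⟩ := (hlim.eventually_lt_const (ENNReal.ofReal_pos.2 hη)).exists
  refine ⟨1 / ((n : ℝ) + 1), by positivity, ?_⟩
  exact ENNReal.toReal_le_of_le_ofReal hη.le hn.le

/-- Fast crossings of annuli with distant centres are nearly independent. -/
lemma measureReal_crosses_inter_le [IsProbabilityMeasure P] (h : IsErgodicMetric g P)
    (hqi : IsExpQuasiIndep g P) : ∃ β : ℝ, 0 < β ∧ ∃ R₀ : ℝ, 0 < R₀ ∧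
      ∀ R ≥ R₀, ∀ r, 0 < r → r ≤ R → ∀ t,
      ∀ y₁ y₂ : Space d, 6 * R ≤ dist y₁ y₂ →
      P.real ({ω | Crosses (g ω) y₁ r R t} ∩ {ω | Crosses (g ω) y₂ r R t})
        ≤ crossProb g P r R t ^ 2 + Real.exp (-(R ^ β)) := by
  obtain ⟨β, hβ, hq⟩ := hqi
  -- with `Q = R` and `α = 1`, balls of radius `2 * R` have diameter at most `Q ^ (1 + α)`
  obtain ⟨Q₀, hQ₀, hq⟩ := hq 1 one_pos
  refine ⟨β, hβ, max Q₀ 4, lt_max_of_lt_left hQ₀, fun R hR r hr hrR t y₁ y₂ hy => ?_⟩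
  have hRQ : Q₀ ≤ R := (le_max_left _ _).trans hR
  have hR4 : 4 ≤ R := (le_max_right _ _).trans hR
  have hdiam : ∀ y : Space d,
      Metric.ediam (Metric.ball y (2 * R)) ≤ ENNReal.ofReal (R ^ ((1 : ℝ) + 1)) := by
    intro y
    refine Metric.ediam_le fun a ha b hb => ?_
    rw [edist_dist]
    refine ENNReal.ofReal_le_ofReal ?_
    rw [Metric.mem_ball] at ha hb
    have h1 := dist_triangle_right a b y
    have h2 : R ^ ((1 : ℝ) + 1) = R * R := by
      rw [Real.rpow_add (by linarith), Real.rpow_one]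
    rw [h2]
    nlinarith
  have h1 := abs_le_indMinus (hdiam y₁) (hdiam y₂) (ofReal_lt_setDist_ball (by linarith) hy)
    (isDecreasingEventOver_crossingSet h.regular y₁ hr hrR t)
    (isDecreasingEventOver_crossingSet h.regular y₂ hr hrR t)
  have e1 := distEvent_crossingSet h.regular y₁ hr hrR t
  have e2 := distEvent_crossingSet h.regular y₂ hr hrR t
  rw [measureReal_congr (e1.inter e2), measureReal_congr e1, measureReal_congr e2,
    h.measureReal_crosses y₁ hr hrR, h.measureReal_crosses y₂ hr hrR] at h1
  have h2 := (le_abs_self _).trans (h1.trans (hq R hRQ))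
  rw [sq]
  linarith

end IsErgodicMetric

end Crossings

section Positivity

variable {d : ℕ} {M : MatrixField d} {Ω : Type*} [MeasurableSpace Ω] {P : Measure Ω}
  {g : Ω → MatrixField d}

/-! ### From one scale to the next -/

/-- Iterated halving: a ball is covered by `K ^ n` balls of `2 ^ n` times smaller radius. -/
lemma exists_cover_closedBall (d : ℕ) : ∃ K : ℕ, 2 ≤ K ∧ ∀ (n : ℕ) (x : Space d) (ρ : ℝ), 0 < ρ →
    ∃ F : Finset (Space d), F.card ≤ K ^ n ∧
      ∀ z ∈ Metric.closedBall x ρ, ∃ y ∈ F, dist z y ≤ ρ / 2 ^ n := by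
  classical
  obtain ⟨S, -, hSf, hS⟩ :=
    (isCompact_closedBall (0 : Space d) 1).finite_cover_balls (e := 1 / 2) (by norm_num)
  obtain ⟨S, rfl⟩ := hSf.exists_finset_coe
  refine ⟨max 2 S.card, le_max_left _ _, fun n => ?_⟩
  induction n with
  | zero => exact fun x ρ _ => ⟨{x}, by simp, fun z hz => ⟨x, by simp, by simpa using hz⟩⟩
  | succ n ih =>
    intro x ρ hρ
    obtain ⟨F, hF, hcov⟩ := ih x ρ hρ
    have hr : 0 < ρ / 2 ^ n := by positivity
    set r := ρ / 2 ^ n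
    refine ⟨Finset.image₂ (fun y s => y + r • s) F S, ?_, fun z hz => ?_⟩
    · refine (Finset.card_image₂_le _ _ _).trans ?_
      rw [pow_succ]
      exact Nat.mul_le_mul hF (le_max_right _ _)
    · obtain ⟨y, hy, hzy⟩ := hcov z hz
      have hmem : r⁻¹ • (z - y) ∈ Metric.closedBall (0 : Space d) 1 := by
        rw [mem_closedBall_zero_iff, norm_smul, norm_inv, Real.norm_eq_abs, abs_of_pos hr,
          ← dist_eq_norm, inv_mul_le_one₀ hr]
        exact hzy
      obtain ⟨s, hs, hds⟩ := Set.mem_iUnion₂.1 (hS hmem)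
      refine ⟨y + r • s, Finset.mem_image₂_of_mem hy hs, ?_⟩
      rw [Metric.mem_ball, dist_eq_norm] at hds
      have e : z - (y + r • s) = r • (r⁻¹ • (z - y) - s) := by
        rw [smul_sub, smul_inv_smul₀ hr.ne']; abel
      rw [dist_eq_norm, e, norm_smul, Real.norm_eq_abs, abs_of_pos hr, pow_succ, ← div_div]
      change r * _ ≤ r / 2
      nlinarith

/-- A path crossing a large annulus passes near the points of a net at `L - 4` successive radii.
If two points of the net which are crossed fast are never far apart, the fast crossings
occur at no more than seven of these radii, and the time spent is at least `(L - 11) * t`. -/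
lemma IsRegular.not_crosses_of_pairs (hM : IsRegular M) {x : Space d} {R t r' : ℝ} {L : ℕ}
    (hR : 0 < R) (ht : 0 ≤ t) (hL : 11 ≤ L) (hr'R : r' ≤ R) {F : Set (Space d)}
    (hF : ∀ z ∈ Metric.closedBall x (L * R), ∃ y ∈ F, dist z y < R / L)
    (hpair : ∀ y₁ ∈ F, ∀ y₂ ∈ F, 6 * R ≤ dist y₁ y₂ →
      ¬(Crosses M y₁ (R / L) R t ∧ Crosses M y₂ (R / L) R t)) :
    ¬Crosses M x r' (L * R) ((L - 11) * t) := by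
  classical
  have hL0 : (11 : ℝ) ≤ L := by exact_mod_cast hL
  have hLpos : (0 : ℝ) < L := by linarith
  set r := R / L with hr
  have hr0 : 0 < r := by positivity
  have hrL : L * r = R := by rw [hr]; field_simp
  have hrR : 11 * r ≤ R := by nlinarith
  -- successive radii differ by the distance between the two boundary spheres of an annulus whose
  -- centre is within `r` of the path
  let ρ : ℕ → ℝ := fun i => r' + i * (R + 2 * r)
  let bad : ℕ → Prop := fun i => ∃ y ∈ F, Crosses M y r R t ∧ ∃ z, dist z x = ρ i ∧ dist z y < r
  have hρ : ∀ i, i + 4 ≤ L → ρ i ≤ (L - 1) * R := by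
    intro i hi
    have hi' : (i : ℝ) + 4 ≤ L := by exact_mod_cast hi
    have hi0 : (0 : ℝ) ≤ i := Nat.cast_nonneg i
    simp only [ρ]
    nlinarith
  have hstep : ∀ i, ρ (i + 1) = ρ i + (R + 2 * r) := by
    intro i; simp only [ρ]; push_cast; ring
  have hlow : ∀ j, j + 3 ≤ L → ∀ p ∈ Metric.ball x r', ∀ w, ρ j ≤ dist w x →
      (((Finset.range j).filter fun i => ¬bad i).card : ℝ) * t ≤ riemDist M p w := by
    intro j
    induction j with
    | zero => intro _ p _ w _; simpa using riemDist_nonneg M p w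
    | succ j ih =>
      intro hj p hp w hw
      have hρj := hρ j (by omega)
      have hjw := hstep j
      refine le_of_forall_pos_le_add fun ε hε => ?_
      have hpj : dist p x ≤ ρ j := by
        have h0 : (0 : ℝ) ≤ j * (R + 2 * r) := by positivity
        have := Metric.mem_ball.1 hp
        simp only [ρ]
        linarith
      obtain ⟨z, hz, hzle⟩ := hM.exists_mem_sphere x hpj (by linarith : ρ j ≤ dist w x) hε
      have h1 := ih (by omega) p hp z hz.ge
      rw [Finset.range_add_one, Finset.filter_insert]
      by_cases hb : bad j
      · rw [if_neg (not_not.2 hb)]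
        have := riemDist_nonneg M z w
        linarith
      · rw [if_pos hb, Finset.card_insert_of_notMem (by simp)]
        obtain ⟨y, hy, hzy⟩ := hF z (Metric.mem_closedBall.2 (by rw [hz]; nlinarith))
        have hyc : ¬Crosses M y r R t := fun hc => hb ⟨y, hy, hc, z, hz, hzy⟩
        have hzw : t ≤ riemDist M z w := by
          by_contra! hlt
          refine hyc ⟨z, hzy, w, ?_, hlt⟩
          rw [Metric.mem_closedBall, not_le]
          have h4 := dist_triangle4 w y z x
          rw [dist_comm y z] at h4
          linarith
        push_cast
        linarith
  have hbad : ∀ i j, i ≤ j → bad i → bad j → j < i + 7 := by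
    rintro i j hij ⟨y, hy, hyc, z, hz, hzy⟩ ⟨y', hy', hyc', z', hz', hzy'⟩
    by_contra! hij7
    refine hpair y hy y' hy' ?_ ⟨hyc, hyc'⟩
    have h1 : (i : ℝ) + 7 ≤ j := by exact_mod_cast hij7
    have h2 : ρ i + 7 * R ≤ ρ j := by simp only [ρ]; nlinarith
    have h3 := dist_triangle4 z' y' y z
    have h4 := dist_triangle z' z x
    rw [dist_comm y z, dist_comm y' y] at h3
    linarith
  have hcard : ((Finset.range (L - 4)).filter fun i => bad i).card ≤ 7 := by
    rcases Finset.eq_empty_or_nonempty ((Finset.range (L - 4)).filter fun i => bad i) with h | h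
    · simp [h]
    · set i₀ := ((Finset.range (L - 4)).filter fun i => bad i).min' h with hi₀
      have hi₀b := (Finset.mem_filter.1 (Finset.min'_mem _ h)).2
      have hsub : (Finset.range (L - 4)).filter (fun i => bad i) ⊆ Finset.Ico i₀ (i₀ + 7) := by
        intro j hj
        have hle := Finset.min'_le _ j hj
        exact Finset.mem_Ico.2 ⟨hle, hbad _ _ hle hi₀b (Finset.mem_filter.1 hj).2⟩
      have := Finset.card_le_card hsub
      simpa using this
  have hgood : (L : ℝ) - 11 ≤ ((Finset.range (L - 4)).filter fun i => ¬bad i).card := by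
    have h1 : ((Finset.range (L - 4)).filter fun i => bad i).card
        + ((Finset.range (L - 4)).filter fun i => ¬bad i).card = L - 4 := by
      convert Finset.card_filter_add_card_filter_not (s := Finset.range (L - 4)) bad
      exact (Finset.card_range _).symm
    have h2 : L ≤ ((Finset.range (L - 4)).filter fun i => ¬bad i).card + 11 := by omega
    have h3 : (L : ℝ) ≤ ((Finset.range (L - 4)).filter fun i => ¬bad i).card + 11 := by
      exact_mod_cast h2
    linarith
  rintro ⟨p, hp, w, hw, hlt⟩
  rw [Metric.mem_closedBall, not_le] at hw
  have hρL : ρ (L - 4) ≤ dist w x := by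
    have := hρ (L - 4) (by omega)
    nlinarith
  have h1 := hlow (L - 4) (by omega) p hp w hρL
  nlinarith

/-- One step of the renormalization: a fast crossing at the scale `2 ^ n * R` produces two
distant fast crossings at the scale `R`. -/
lemma IsErgodicMetric.exists_crossProb_step [IsProbabilityMeasure P] (h : IsErgodicMetric g P)
    (hqi : IsExpQuasiIndep g P) :
    ∃ K : ℕ, 2 ≤ K ∧ ∃ β : ℝ, 0 < β ∧ ∃ R₀ : ℝ, 0 < R₀ ∧ ∀ R ≥ R₀, ∀ n : ℕ, 4 ≤ n → ∀ t : ℝ,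
      0 ≤ t → ∀ r' : ℝ, 0 < r' → r' ≤ R →
      crossProb g P r' (2 ^ n * R) ((2 ^ n - 11) * t)
        ≤ K ^ (2 * (2 * n + 1)) * (crossProb g P (R / 2 ^ n) R t ^ 2 + Real.exp (-(R ^ β))) := by
  classical
  obtain ⟨K, hK, hcov⟩ := exists_cover_closedBall d
  obtain ⟨β, hβ, R₀, hR₀, hind⟩ := h.measureReal_crosses_inter_le hqi
  refine ⟨K, hK, β, hβ, R₀, hR₀, fun R hR n hn t ht r' hr'0 hr'R => ?_⟩
  have hRpos : 0 < R := hR₀.trans_le hR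
  have hpow : (0 : ℝ) < 2 ^ n := by positivity
  have hpow1 : (1 : ℝ) ≤ 2 ^ n := one_le_pow₀ (by norm_num)
  obtain ⟨F, hFc, hF⟩ := hcov (2 * n + 1) (0 : Space d) (2 ^ n * R) (by positivity)
  set r := R / 2 ^ n with hr
  have hr0 : 0 < r := by positivity
  have hrR : r ≤ R := div_le_self hRpos.le hpow1
  have hF' : ∀ z ∈ Metric.closedBall (0 : Space d) (2 ^ n * R), ∃ y ∈ F, dist z y < r := by
    intro z hz
    obtain ⟨y, hy, hzy⟩ := hF z hz
    refine ⟨y, hy, hzy.trans_lt ?_⟩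
    have : (2 : ℝ) ^ n * R / 2 ^ (2 * n + 1) = r / 2 := by
      rw [hr, pow_succ, two_mul, pow_add]; field_simp
    rw [this]
    linarith
  let E : Space d → Set Ω := fun y => {ω | Crosses (g ω) y r R t}
  let pairs := (F ×ˢ F).filter fun y => 6 * R ≤ dist y.1 y.2
  set b := crossProb g P r R t ^ 2 + Real.exp (-(R ^ β)) with hb
  have hb0 : 0 ≤ b := by positivity
  have hsub : {ω | Crosses (g ω) 0 r' (2 ^ n * R) ((2 ^ n - 11) * t)}
      ≤ᵐ[P] ⋃ y ∈ pairs, E y.1 ∩ E y.2 := by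
    filter_upwards [h.regular] with ω hω
    change _ → _
    intro hc
    by_contra hcon
    have hcon' : ∀ y ∈ pairs, ¬(Crosses (g ω) y.1 r R t ∧ Crosses (g ω) y.2 r R t) :=
      fun y hy hyc => hcon (Set.mem_iUnion₂.2 ⟨y, hy, hyc⟩)
    have hL : ((2 ^ n : ℕ) : ℝ) = 2 ^ n := by push_cast; rfl
    have h11 : 11 ≤ 2 ^ n := le_trans (by norm_num) (Nat.pow_le_pow_right two_pos hn)
    refine hω.not_crosses_of_pairs (x := 0) (F := (F : Set (Space d))) hRpos ht h11 hr'R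
      ?_ ?_ (by rw [hL]; exact hc)
    · rw [hL]; exact hF'
    · rw [hL]
      intro y₁ hy₁ y₂ hy₂ hd
      exact hcon' (y₁, y₂) (Finset.mem_filter.2 ⟨Finset.mk_mem_product hy₁ hy₂, hd⟩)
  calc crossProb g P r' (2 ^ n * R) ((2 ^ n - 11) * t)
      ≤ P.real (⋃ y ∈ pairs, E y.1 ∩ E y.2) :=
        ENNReal.toReal_mono (measure_ne_top _ _) (measure_mono_ae hsub)
    _ ≤ ∑ y ∈ pairs, P.real (E y.1 ∩ E y.2) := measureReal_biUnion_finset_le _ _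
    _ ≤ ∑ _y ∈ pairs, b := Finset.sum_le_sum fun y hy =>
        hind R hR r hr0 hrR t y.1 y.2 (Finset.mem_filter.1 hy).2
    _ = pairs.card * b := by rw [Finset.sum_const, nsmul_eq_mul]
    _ ≤ K ^ (2 * (2 * n + 1)) * b := by
        refine mul_le_mul_of_nonneg_right ?_ hb0
        have h1 : pairs.card ≤ K ^ (2 * n + 1) * K ^ (2 * n + 1) :=
          (Finset.card_filter_le _ _).trans
            ((Finset.card_product F F).trans_le (Nat.mul_le_mul hFc hFc))
        rw [← pow_add, ← two_mul] at h1
        exact_mod_cast h1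

/-! ### Positivity of the time constant -/

/-- A stretched exponential at scales growing geometrically beats any exponential, uniformly if the
first scale is large. -/
lemma exists_forall_mul_pow_le_exp {A β : ℝ} (hA : 1 ≤ A) (hβ : 0 < β) :
    ∃ R₁ : ℝ, 1 ≤ R₁ ∧ ∀ R ≥ R₁, ∀ k : ℕ,
      4 * A ^ (4 * (6 + k) + 3) ≤ Real.exp ((R * 2 ^ k) ^ β) := by
  set a := min 1 ((2 : ℝ) ^ β - 1) with ha
  have h2β : (1 : ℝ) < 2 ^ β := Real.one_lt_rpow (by norm_num) hβ
  have ha0 : 0 < a := lt_min one_pos (by linarith)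
  set c := Real.log 4 + 27 * Real.log A
  have hlogA : 0 ≤ Real.log A := Real.log_nonneg hA
  have hlog4 : 0 ≤ Real.log 4 := Real.log_nonneg (by norm_num)
  obtain ⟨R₁, hR₁⟩ := eventually_atTop.1
    ((tendsto_rpow_atTop hβ).eventually_ge_atTop (c / a))
  refine ⟨max 1 R₁, le_max_left _ _, fun R hR k => ?_⟩
  have hR0 : 0 ≤ R := zero_le_one.trans ((le_max_left _ _).trans hR)
  have hc : c ≤ R ^ β * a := (div_le_iff₀ ha0).1 (hR₁ R ((le_max_right _ _).trans hR))
  have hA0 : 0 < A := by linarith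
  rw [← Real.log_le_iff_le_exp (by positivity), Real.log_mul (by norm_num) (by positivity),
    Real.log_pow, Real.mul_rpow hR0 (by positivity), ← Real.rpow_natCast, ← Real.rpow_mul
    (by norm_num), mul_comm (k : ℝ) β, Real.rpow_mul (by norm_num), Real.rpow_natCast]
  have hbern : 1 + (k : ℝ) * (2 ^ β - 1) ≤ ((2 : ℝ) ^ β) ^ k := by
    have := one_add_mul_le_pow (a := (2 : ℝ) ^ β - 1) (by linarith) k
    rwa [add_sub_cancel] at this
  have hk : (0 : ℝ) ≤ k := Nat.cast_nonneg k
  have h1 : a * (k + 1) ≤ ((2 : ℝ) ^ β) ^ k := by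
    have h3 : a * k ≤ (2 ^ β - 1) * k := mul_le_mul_of_nonneg_right (min_le_right _ _) hk
    have h4 : a ≤ 1 := min_le_left _ _
    nlinarith
  have hRβ : 0 ≤ R ^ β := Real.rpow_nonneg hR0 β
  calc Real.log 4 + ((4 * (6 + k) + 3 : ℕ) : ℝ) * Real.log A ≤ c * (k + 1) := by
        push_cast
        have h5 : 0 ≤ k * Real.log A := mul_nonneg hk hlogA
        have h6 : 0 ≤ k * Real.log 4 := mul_nonneg hk hlog4
        simp only [c]
        nlinarith
    _ ≤ R ^ β * a * (k + 1) := mul_le_mul_of_nonneg_right hc (by positivity)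
    _ = R ^ β * (a * (k + 1)) := by ring
    _ ≤ R ^ β * ((2 : ℝ) ^ β) ^ k := mul_le_mul_of_nonneg_left h1 hRβ

/-- The scales `R₀ * ∏ 2 ^ (6 + j)` of the renormalization. -/
noncomputable def scale (R₀ : ℝ) : ℕ → ℝ
  | 0 => R₀
  | k + 1 => 2 ^ (6 + k) * scale R₀ k

/-- The crossing times at the successive scales. -/
noncomputable def scaleTime (t₀ : ℝ) : ℕ → ℝ
  | 0 => t₀
  | k + 1 => (2 ^ (6 + k) - 11) * scaleTime t₀ k

lemma mul_two_pow_le_scale {R₀ : ℝ} (hR₀ : 0 ≤ R₀) (k : ℕ) : R₀ * 2 ^ k ≤ scale R₀ k := by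
  induction k with
  | zero => simp [scale]
  | succ k ih =>
    rw [scale, pow_succ]
    have h1 : (2 : ℝ) ≤ 2 ^ (6 + k) := le_self_pow₀ (by norm_num) (by omega)
    have h2 : 0 ≤ R₀ * 2 ^ k := by positivity
    nlinarith

lemma scaleTime_nonneg {t₀ : ℝ} (ht₀ : 0 ≤ t₀) (k : ℕ) : 0 ≤ scaleTime t₀ k := by
  induction k with
  | zero => exact ht₀
  | succ k ih =>
    have h1 : (2 : ℝ) ^ 6 ≤ 2 ^ (6 + k) := pow_le_pow_right₀ (by norm_num) (by omega)
    exact mul_nonneg (by linarith) ih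

/-- The ratio of the times to the scales is multiplied by `1 - 11 / 2 ^ (6 + k)` in each step, and
these factors have a positive product. -/
lemma mul_scale_le_scaleTime {R₀ t₀ : ℝ} (hR₀ : 0 < R₀) (ht₀ : 0 ≤ t₀) (k : ℕ) :
    t₀ / (2 * R₀) * scale R₀ k ≤ scaleTime t₀ k := by
  have key : ∀ k : ℕ, (1 / 2 + 11 / 32 / 2 ^ k) * (t₀ / R₀) * scale R₀ k ≤ scaleTime t₀ k := by
    intro k
    induction k with
    | zero =>
      simp only [scale, scaleTime, pow_zero]
      rw [mul_assoc, div_mul_cancel₀ _ hR₀.ne']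
      nlinarith
    | succ k ih =>
      have h0 : 0 ≤ t₀ / R₀ * scale R₀ k := by
        have := mul_two_pow_le_scale hR₀.le k
        have : 0 ≤ scale R₀ k := le_trans (by positivity) this
        positivity
      have hx : (1 : ℝ) ≤ 2 ^ k := one_le_pow₀ (by norm_num)
      set x : ℝ := 2 ^ k
      have h1 : (2 : ℝ) ^ (6 + k) = 64 * x := by rw [pow_add]; norm_num [x]
      have h2 : (2 : ℝ) ^ (k + 1) = 2 * x := by rw [pow_succ]; ring
      rw [scale, scaleTime, h1, h2]
      have h3 : (1 / 2 + 11 / 32 / (2 * x)) * (64 * x) ≤ (64 * x - 11) * (1 / 2 + 11 / 32 / x) := by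
        field_simp
        nlinarith
      calc (1 / 2 + 11 / 32 / (2 * x)) * (t₀ / R₀) * (64 * x * scale R₀ k)
          = (1 / 2 + 11 / 32 / (2 * x)) * (64 * x) * (t₀ / R₀ * scale R₀ k) := by ring
        _ ≤ (64 * x - 11) * (1 / 2 + 11 / 32 / x) * (t₀ / R₀ * scale R₀ k) :=
            mul_le_mul_of_nonneg_right h3 h0
        _ = (64 * x - 11) * ((1 / 2 + 11 / 32 / x) * (t₀ / R₀) * scale R₀ k) := by ring
        _ ≤ (64 * x - 11) * scaleTime t₀ k :=
            mul_le_mul_of_nonneg_left ih (by linarith)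
  refine le_trans ?_ (key k)
  have h0 : 0 ≤ t₀ / R₀ * scale R₀ k := by
    have := mul_two_pow_le_scale hR₀.le k
    have : 0 ≤ scale R₀ k := le_trans (by positivity) this
    positivity
  have h1 : (0 : ℝ) ≤ 11 / 32 / 2 ^ k := by positivity
  have h2 : t₀ / (2 * R₀) * scale R₀ k = 1 / 2 * (t₀ / R₀ * scale R₀ k) := by
    field_simp
  rw [h2, mul_assoc]
  exact mul_le_mul_of_nonneg_right (by linarith) h0

/-- Crossings of annuli at linear speed are likely to fail at arbitrarily large scales. -/
lemma IsErgodicMetric.exists_crossProb_le_half [IsProbabilityMeasure P] (h : IsErgodicMetric g P)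
    (hqi : IsExpQuasiIndep g P) : ∃ c > 0, ∃ R : ℕ → ℝ, (∀ k, 2 ^ k ≤ R k) ∧
      ∀ k, ∃ r > 0, crossProb g P r (R k) (c * R k) ≤ 1 / 2 := by
  obtain ⟨K, hK, β, hβ, R₀, hR₀, hstep⟩ := h.exists_crossProb_step hqi
  have hK1 : (1 : ℝ) ≤ K := by exact_mod_cast (by omega : 1 ≤ K)
  set A : ℝ := (K : ℝ) ^ 6 with hA
  have hA1 : 1 ≤ A := one_le_pow₀ hK1
  have hA0 : 0 < A := by linarith
  obtain ⟨R₁, hR₁, hexp⟩ := exists_forall_mul_pow_le_exp hA1 hβ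
  set S := max R₀ R₁ with hS
  have hS1 : 1 ≤ S := hR₁.trans (le_max_right _ _)
  have hS0 : 0 < S := by linarith
  have hscale : ∀ k, S * 2 ^ k ≤ scale S k := mul_two_pow_le_scale hS0.le
  have hscaleS : ∀ k, S ≤ scale S k := fun k =>
    (le_mul_of_one_le_right hS0.le (one_le_pow₀ (by norm_num))).trans (hscale k)
  -- the time at the first scale is chosen so small that a fast crossing is unlikely there
  obtain ⟨t₀, ht₀, hinit⟩ := h.exists_crossProb_le (r := S / 2 ^ 6) (R := S) (by positivity)
    (div_lt_self hS0 (by norm_num)) (η := (2 * A ^ 18)⁻¹) (by positivity)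
  have hmain : ∀ k, crossProb g P (scale S k / 2 ^ (6 + k)) (scale S k) (scaleTime t₀ k)
      ≤ (2 * A ^ (3 * (6 + k)))⁻¹ := by
    intro k
    induction k with
    | zero => simpa [scale, scaleTime] using hinit
    | succ k ih =>
      have hspos : 0 < scale S k := hS0.trans_le (hscaleS k)
      have hr' : scale S (k + 1) / 2 ^ (6 + (k + 1)) = scale S k / 2 := by
        rw [scale, ← add_assoc, pow_succ]; field_simp
      have h1 := hstep (scale S k) ((le_max_left _ _).trans (hscaleS k)) (6 + k) (by omega)
        (scaleTime t₀ k) (scaleTime_nonneg ht₀.le k) (scale S k / 2) (by positivity) (by linarith)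
      rw [hr', scale, scaleTime]
      refine h1.trans ?_
      set n := 6 + k with hn
      have hp0 : 0 ≤ crossProb g P (scale S k / 2 ^ n) (scale S k) (scaleTime t₀ k) :=
        measureReal_nonneg
      have hf : crossProb g P (scale S k / 2 ^ n) (scale S k) (scaleTime t₀ k) ^ 2
          ≤ (4 * A ^ (4 * n + 3))⁻¹ := by
        refine (pow_le_pow_left₀ hp0 ih 2).trans ?_
        rw [inv_pow]
        refine inv_anti₀ (by positivity) ?_
        have : A ^ (4 * n + 3) ≤ A ^ (3 * n * 2) := pow_le_pow_right₀ hA1 (by omega)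
        rw [mul_pow, ← pow_mul A]
        linarith
      have he : Real.exp (-(scale S k ^ β)) ≤ (4 * A ^ (4 * n + 3))⁻¹ := by
        rw [Real.exp_neg]
        refine inv_anti₀ (by positivity) ((hexp S (le_max_right _ _) k).trans ?_)
        exact Real.exp_le_exp.2 (Real.rpow_le_rpow (by positivity) (hscale k) hβ.le)
      have hKA : (K : ℝ) ^ (2 * (2 * n + 1)) ≤ A ^ n := by
        rw [hA, ← pow_mul]
        exact pow_le_pow_right₀ hK1 (by omega)
      calc (K : ℝ) ^ (2 * (2 * n + 1))
            * (crossProb g P (scale S k / 2 ^ n) (scale S k) (scaleTime t₀ k) ^ 2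
              + Real.exp (-(scale S k ^ β)))
          ≤ A ^ n * ((4 * A ^ (4 * n + 3))⁻¹ + (4 * A ^ (4 * n + 3))⁻¹) := by gcongr
        _ = (2 * A ^ (3 * (6 + (k + 1))))⁻¹ := by
          have e : A ^ (4 * n + 3) = A ^ n * A ^ (3 * (6 + (k + 1))) := by
            rw [← pow_add]; congr 1; omega
          rw [e]
          field_simp
          norm_num
  refine ⟨t₀ / (2 * S), by positivity, scale S, fun k => ?_, fun k => ?_⟩
  · exact (le_mul_of_one_le_left (by positivity) hS1).trans (hscale k)
  · refine ⟨scale S k / 2 ^ (6 + k), div_pos (hS0.trans_le (hscaleS k)) (by positivity), ?_⟩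
    calc crossProb g P (scale S k / 2 ^ (6 + k)) (scale S k) (t₀ / (2 * S) * scale S k)
        ≤ crossProb g P (scale S k / 2 ^ (6 + k)) (scale S k) (scaleTime t₀ k) := by
          refine measureReal_mono ?_ (measure_ne_top _ _)
          rintro ω ⟨p, hp, q, hq, hlt⟩
          exact ⟨p, hp, q, hq, hlt.trans_le (mul_scale_le_scaleTime hS0 ht₀.le k)⟩
      _ ≤ (2 * A ^ (3 * (6 + k)))⁻¹ := hmain k
      _ ≤ 1 / 2 := by
          rw [one_div]
          refine inv_anti₀ two_pos ?_
          have : 1 ≤ A ^ (3 * (6 + k)) := one_le_pow₀ hA1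
          linarith

lemma IsErgodicMetric.timeConst_pos [IsProbabilityMeasure P] (h : IsErgodicMetric g P)
    (hqi : IsExpQuasiIndep g P) {v : Space d} (hv : v ≠ 0) : 0 < timeConst g P v := by
  obtain ⟨c, hc, R, hR, hcr⟩ := h.exists_crossProb_le_half hqi
  have hvn : 0 < ‖v‖ := norm_pos_iff.2 hv
  have hR1 : ∀ k, 1 ≤ R k := fun k => (one_le_pow₀ (by norm_num)).trans (hR k)
  have hRlim : Tendsto R atTop atTop :=
    tendsto_atTop_mono hR (tendsto_pow_atTop_atTop_of_one_lt (by norm_num))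
  have hlim := (h.tendsto_meanDist v).comp
    ((tendsto_atTop_add_const_right atTop 1 hRlim).atTop_div_const hvn)
  refine lt_of_lt_of_le (by positivity : 0 < c * ‖v‖ / 4) (ge_of_tendsto' hlim fun k => ?_)
  have hRk := hR1 k
  obtain ⟨r, hr, hcross⟩ := hcr k
  set s := (R k + 1) / ‖v‖ with hs
  have hs0 : 0 < s := by positivity
  have hnorm : ‖s • v‖ = R k + 1 := by
    rw [norm_smul, Real.norm_eq_abs, abs_of_pos hs0, hs, div_mul_cancel₀ _ hvn.ne']
  -- the point `s • v` lies outside the annulus, so half of the time it takes `c * R k` to reach it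
  have hhalf : 1 / 2 ≤ P.real {ω | c * R k ≤ riemDist (g ω) 0 (s • v)} := by
    have huniv : (Set.univ : Set Ω) ⊆ {ω | Crosses (g ω) 0 r (R k) (c * R k)}
        ∪ {ω | c * R k ≤ riemDist (g ω) 0 (s • v)} := by
      intro ω _
      rcases lt_or_ge (riemDist (g ω) 0 (s • v)) (c * R k) with hlt | hge
      · refine Or.inl ⟨0, Metric.mem_ball_self hr, s • v, ?_, hlt⟩
        rw [mem_closedBall_zero_iff, hnorm]
        linarith
      · exact Or.inr hge
    have h1 := (measureReal_mono (μ := P) huniv (measure_ne_top _ _)).trans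
      (measureReal_union_le _ _)
    rw [probReal_univ] at h1
    have h2 : P.real {ω | Crosses (g ω) 0 r (R k) (c * R k)} ≤ 1 / 2 := hcross
    linarith
  have hmarkov := mul_meas_ge_le_integral_of_nonneg (μ := P)
    (.of_forall fun ω => riemDist_nonneg (g ω) 0 (s • v)) (h.integrable 0 (s • v)) (c * R k)
  have hmean : c * R k / 2 ≤ meanDist g P (s • v) := by
    refine le_trans ?_ hmarkov
    have : 0 ≤ c * R k := by positivity
    nlinarith
  change c * ‖v‖ / 4 ≤ meanDist g P (s • v) / s
  rw [le_div_iff₀ hs0]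
  have e : c * ‖v‖ / 4 * s = c * (R k + 1) / 4 := by rw [hs]; field_simp
  rw [e]
  nlinarith

end Positivity

end RiemannianFPP

theorem mainTheorem5 {d : ℕ} {Ω : Type*} [MeasurableSpace Ω]
    (P : MeasureTheory.Measure Ω) [MeasureTheory.IsProbabilityMeasure P]
    (g : Ω → RiemannianFPP.MatrixField d)
    (hg : RiemannianFPP.IsRandomMetric g)
    (herg : RiemannianFPP.IsErgodicField g P)
    (hcont : ∀ᵐ ω ∂P, Continuous (g ω))
    (hmoment : ∀ v : RiemannianFPP.Space d,
      MeasureTheory.Integrable (fun ω => RiemannianFPP.matrixNorm (g ω 0) v) P) :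
    (RiemannianFPP.IsExpQuasiIndep g P →
      ∃ μ : RiemannianFPP.Space d → ℝ,
        RiemannianFPP.IsTimeConstant g P μ ∧ RiemannianFPP.IsNorm μ) ∧
    (RiemannianFPP.HasFiniteRange g P →
      ∃ μ : RiemannianFPP.Space d → ℝ,
        RiemannianFPP.IsTimeConstant g P μ ∧ RiemannianFPP.IsNorm μ) := by
  have h : RiemannianFPP.IsErgodicMetric g P :=
    ⟨hg, herg, hcont.mono fun ω hω => ⟨hω, hg.posDef ω⟩, hmoment⟩
  have key (hqi : RiemannianFPP.IsExpQuasiIndep g P) :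
      ∃ μ : RiemannianFPP.Space d → ℝ,
        RiemannianFPP.IsTimeConstant g P μ ∧ RiemannianFPP.IsNorm μ :=
    ⟨RiemannianFPP.timeConst g P, h.isTimeConstant,
      fun _ hv => h.timeConst_pos hqi hv, h.timeConst_smul, h.timeConst_add_le⟩
  exact ⟨key, fun hfr => key hfr.isExpQuasiIndep⟩
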